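/- **Setting.** Let $n,d\ge 1$, $A\in\mathbb R^{n\times d}$, $b,w\in\mathbb R^n$, and let $c\in[0,1]^n$ be the given vector of leverage scores. Put $s(x)=Ax-b$, $S(x)=\mathrm{diag}(s(x))$, $A(x)=S(x)^{-1}A$, $\sigma(x)=A(x)(A(x)^\top A(x))^{-1}A(x)^\top$, $W=\mathrm{diag}(w)$, and consider the regularized loss $$L(x)=\tfrac12\sum_{i=1}^n(\sigma(x)_{i,i}-c_i)^2+\tfrac12\|WAx\|_2^2 ,\qquad x\in\mathbb R^d .$$ The exact Newton iteration is $x_{t+1}=x_t-(\nabla^2L(x_t))^{-1}\nabla L(x_t)$. A point $x^*$ is an $l$-local minimum if $\nabla L(x^*)=0$ and $\nabla^2L(x^*)\succeq l\,I_d$. $\|A\|$ is the spectral norm and $\sigma_{\min}$ the smallest of the $d$ singular values. Time is the number of instructions of a straight-line program over $\mathbb R$ (loading a constant, or $+,-,\times,\div$; no division by zero may occur). $\mathcal T_{\mathrm{mat}}(a,b,c)$ is the least number of instructions with which a program multiplies an arbitrary $a\times b$ matrix by an arbitrary $b\times c$ matrix, and $\omega=\inf\{\tau:\mathcal T_{\mathrm{mat}}(m,m,m)=O(m^\tau)\}$.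 **Theorem.** There is a universal constant $C>0$ such that for all $n,d\ge1$ there is a program, depending only on $n$ and $d$, with at most $$n\cdot C\big(\mathcal T_{\mathrm{mat}}(d,n,n)+\mathcal T_{\mathrm{mat}}(d,n,d)\big)+d^{\omega}$$ instructions, for which the following hold. 1. *(Time per iteration.)* For all $A,b,w$, all $c\in\mathbb R^n$ and all $x$ such that $s(x)$ has no zero entry and $A(x)^\top A(x)$ and $\nabla^2L(x)$ are invertible, the program, run on $(A,b,c,w,x)$, outputs $x-(\nabla^2L(x))^{-1}\nabla L(x)$. 2. *(Positive definiteness by regularization.)* Let $c\in[0,1]^n$, $l>0$, $\gamma>0$, $\sigma_{\min}(A)>0$, and $w_i^2\ge 44\gamma^{-2}+l/\sigma_{\min}(A)^2$ for all $i$. Then $\nabla^2L(x)\succeq l\,I_d$ for every $x$ with $|s(x)_i|\ge\gamma$ for all $i$. In particular, every such $x$ with $\nabla L(x)=0$ is an $l$-local minimum. 3. *(Convergence.)* Let $c\in[0,1]^n$, $l>0$, $R>0$, $\beta\in(0,0.1)$ and $\|A\|\le R$. Let $x^*$ be an $l$-local minimum of $L$, let $x_0\in\mathbb R^d$, $r_0=\|x_0-x^*\|_2$,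 and suppose that for all $x$ with $\|x-x^*\|_2\le r_0$ one has $|s(x)_i|\ge\beta$ for all $i$ and $\sigma_{\min}(A(x))\ge\beta$. Suppose that $x_0$ is a good initialization point, that is, $r_0M\le 0.1\,l$ with $M=812\,\beta^{-9}R^5$. Then, for every $t\ge0$, $s(x_t)$ has no zero entry, $A(x_t)^\top A(x_t)$ is invertible and $\nabla^2L(x_t)$ is positive definite, so that every iteration is well defined and is computed by the program; and for every $\epsilon>0$ and every integer $T\ge1$ with $T\ge\log(r_0/\epsilon)$ (natural logarithm), $$\|x_T-x^*\|_2<\epsilon .$$ -/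

import Mathlib

open scoped Matrix

/-! ### The regularized inverse leverage score problem -/

namespace LevInv

/-- The data of the problem: a matrix `A`, a shift `b`, the given leverage scores `c` and the
regularization weights `w`. -/
structure Data (n d : ℕ) where
  A : Matrix (Fin n) (Fin d) ℝ
  b : Fin n → ℝ
  c : Fin n → ℝ
  w : Fin n → ℝ

/-- The spectral norm `max ‖Ax‖₂ / ‖x‖₂` of a real matrix. -/
noncomputable def specNorm {n d : ℕ} (A : Matrix (Fin n) (Fin d) ℝ) : ℝ :=
  ‖LinearMap.toContinuousLinearMap (Matrix.toEuclideanLin A)‖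

/-- The smallest of the `d` singular values of an `n × d` matrix
(Mathlib lists singular values in decreasing order, starting from index `0`). -/
noncomputable def sigmaMin {n d : ℕ} (A : Matrix (Fin n) (Fin d) ℝ) : ℝ :=
  (Matrix.toEuclideanLin A).singularValues (d - 1)

section Loss

variable {n d : ℕ} (D : Data n d)

/-- `s(x) = A x - b`. -/
def s (x : EuclideanSpace ℝ (Fin d)) : Fin n → ℝ :=
  D.A *ᵥ x.ofLp - D.b

/-- `A(x) = S(x)⁻¹ A`, with `S(x) = diag(s(x))`. -/
noncomputable def Ax (x : EuclideanSpace ℝ (Fin d)) : Matrix (Fin n) (Fin d) ℝ :=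
  (Matrix.diagonal (s D x))⁻¹ * D.A

/-- The leverage score matrix `σ(x) = A(x) (A(x)ᵀ A(x))⁻¹ A(x)ᵀ`. -/
noncomputable def lev (x : EuclideanSpace ℝ (Fin d)) : Matrix (Fin n) (Fin n) ℝ :=
  Ax D x * ((Ax D x)ᵀ * Ax D x)⁻¹ * (Ax D x)ᵀ

/-- `L_exp(x) = 0.5 ∑ᵢ (σ(x)ᵢᵢ - cᵢ)²`. -/
noncomputable def Lexp (x : EuclideanSpace ℝ (Fin d)) : ℝ :=
  (1 / 2) * ∑ i, (lev D x i i - D.c i) ^ 2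

/-- `L_reg(x) = 0.5 ‖W A x‖₂²`, with `W = diag(w)`. -/
noncomputable def Lreg (x : EuclideanSpace ℝ (Fin d)) : ℝ :=
  (1 / 2) * ‖WithLp.toLp 2 ((Matrix.diagonal D.w * D.A) *ᵥ x.ofLp)‖ ^ 2

/-- The regularized loss `L = L_exp + L_reg`. -/
noncomputable def loss (x : EuclideanSpace ℝ (Fin d)) : ℝ :=
  Lexp D x + Lreg D x

end Loss

/-! ### Newton's method -/

/-- The Hessian matrix of second partial derivatives. -/
noncomputable def hessian {d : ℕ} (f : EuclideanSpace ℝ (Fin d) → ℝ)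
    (x : EuclideanSpace ℝ (Fin d)) : Matrix (Fin d) (Fin d) ℝ :=
  Matrix.of fun k j =>
    fderiv ℝ (fun y => fderiv ℝ f y (EuclideanSpace.single j 1)) x (EuclideanSpace.single k 1)

/-- `x` is an `l`-local minimum of `f`: `∇f(x) = 0` and `∇²f(x) ⪰ l I`. -/
def IsLocalMinimum {d : ℕ} (l : ℝ) (f : EuclideanSpace ℝ (Fin d) → ℝ)
    (x : EuclideanSpace ℝ (Fin d)) : Prop :=
  gradient f x = 0 ∧ (hessian f x - l • (1 : Matrix (Fin d) (Fin d) ℝ)).PosSemidef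

/-- One exact Newton update `x - H(x)⁻¹ g(x)`. -/
noncomputable def newtonStep {d : ℕ} (f : EuclideanSpace ℝ (Fin d) → ℝ)
    (x : EuclideanSpace ℝ (Fin d)) : EuclideanSpace ℝ (Fin d) :=
  x - WithLp.toLp 2 ((hessian f x)⁻¹ *ᵥ (gradient f x).ofLp)

/-- The `T`-th iterate of the exact Newton method started at `x₀`. -/
noncomputable def newtonIter {d : ℕ} (f : EuclideanSpace ℝ (Fin d) → ℝ)
    (x₀ : EuclideanSpace ℝ (Fin d)) (T : ℕ) : EuclideanSpace ℝ (Fin d) :=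
  (newtonStep f)^[T] x₀

/-- `x₀` is a good initialization point for `x'`: `‖x₀ - x'‖₂ M ≤ 0.1 l`. -/
def GoodInit {d : ℕ} (l M : ℝ) (x₀ x' : EuclideanSpace ℝ (Fin d)) : Prop :=
  ‖x₀ - x'‖ * M ≤ l / 10

/-- All inverses in a Newton update on the regularized loss are inverses of invertible matrices. -/
def NewtonDefined {n d : ℕ} (D : Data n d) (x : EuclideanSpace ℝ (Fin d)) : Prop :=
  (∀ i, s D x i ≠ 0) ∧ IsUnit ((Ax D x)ᵀ * Ax D x).det ∧ IsUnit (hessian (loss D) x).det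

/-! ### Running time: arithmetic straight-line programs -/

/-- The four arithmetic operations. -/
inductive ArithOp
  | add | sub | mul | div

/-- An instruction loads a constant, or applies an operation to two addresses.
An address is an input variable (`Sum.inl`) or the number of an earlier instruction (`Sum.inr`). -/
inductive Instr (ι : Type)
  | const (r : ℝ)
  | op (o : ArithOp) (p q : ι ⊕ ℕ)

/-- A straight-line program with input variables `ι` and output variables `κ`:
a list of instructions, and the addresses of the outputs. -/
structure Program (ι κ : Type) where
  code : List (Instr ι)
  out : κ → ι ⊕ ℕ

/-- The result of an operation; division by zero is an error. -/
noncomputable def ArithOp.eval : ArithOp → ℝ → ℝ → Option ℝ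
  | .add, u, v => some (u + v)
  | .sub, u, v => some (u - v)
  | .mul, u, v => some (u * v)
  | .div, u, v => open Classical in if v = 0 then none else some (u / v)

/-- The value at an address, given the inputs and the results `m` of the earlier instructions. -/
def readAddr {ι : Type} (inp : ι → ℝ) (m : List ℝ) : ι ⊕ ℕ → Option ℝ
  | .inl i => some (inp i)
  | .inr k => m[k]?

noncomputable def Instr.eval {ι : Type} (inp : ι → ℝ) (m : List ℝ) : Instr ι → Option ℝ
  | .const r => some r
  | .op o p q => (readAddr inp m p).bind fun u => (readAddr inp m q).bind fun v => o.eval u v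

/-- Execute the instructions in order; every instruction appends its result to the memory. -/
noncomputable def execCode {ι : Type} (inp : ι → ℝ) : List (Instr ι) → List ℝ → Option (List ℝ)
  | [], m => some m
  | a :: code, m => (a.eval inp m).bind fun v => execCode inp code (m ++ [v])

/-- The number of steps of a straight-line program. -/
def Program.steps {ι κ : Type} (P : Program ι κ) : ℕ := P.code.length

/-- On the input `inp` the program runs without error and outputs `y`. -/
def Program.Outputs {ι κ : Type} (P : Program ι κ) (inp : ι → ℝ) (y : κ → ℝ) : Prop :=
  ∃ m, execCode inp P.code [] = some m ∧ ∀ k, readAddr inp m (P.out k) = some (y k)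

/-- The entries of an `a × b` matrix and of a `b × c` matrix, as one input. -/
def matInput {a b c : ℕ} (X : Matrix (Fin a) (Fin b) ℝ) (Y : Matrix (Fin b) (Fin c) ℝ) :
    (Fin a × Fin b) ⊕ (Fin b × Fin c) → ℝ
  | .inl p => X p.1 p.2
  | .inr p => Y p.1 p.2

/-- `T_mat(a, b, c)`: the least number of steps in which a program multiplies an arbitrary
`a × b` matrix with an arbitrary `b × c` matrix. -/
noncomputable def Tmat (a b c : ℕ) : ℕ :=
  sInf {N | ∃ P : Program ((Fin a × Fin b) ⊕ (Fin b × Fin c)) (Fin a × Fin c), P.steps = N ∧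
    ∀ (X : Matrix (Fin a) (Fin b) ℝ) (Y : Matrix (Fin b) (Fin c) ℝ),
      P.Outputs (matInput X Y) fun p => (X * Y) p.1 p.2}

/-- The exponent `ω` of matrix multiplication. -/
noncomputable def omega : ℝ :=
  sInf {τ | ∃ K : ℝ, ∀ m : ℕ, 1 ≤ m → (Tmat m m m : ℝ) ≤ K * (m : ℝ) ^ τ}

/-- The input variables of one Newton iteration: the entries of `A`, `b`, `c`, `w`, and of the
current point. -/
inductive NewtonVar (n d : ℕ)
  | A (i : Fin n) (j : Fin d)
  | b (i : Fin n)
  | c (i : Fin n)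
  | w (i : Fin n)
  | x (j : Fin d)

/-- The input of one Newton iteration. -/
def newtonInput {n d : ℕ} (D : Data n d) (x : EuclideanSpace ℝ (Fin d)) : NewtonVar n d → ℝ
  | .A i j => D.A i j
  | .b i => D.b i
  | .c i => D.c i
  | .w i => D.w i
  | .x j => x j

end LevInv

/-! Write `σ` for the leverage matrix, `J = σ ∘ σ - diag σ` and `z = A(x) v`. Differentiating the
inverse Gram matrix gives `Dσ[v] = 2 σ Z σ - Z σ - σ Z` with `Z = diag z`, so the leverage scores
have derivative `2 J z`. A second differentiation gives the Hessian `A(x)ᵀ (4 J² + B) A(x) + Aᵀ W²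
A`, where `B` (`indef`) is linear in the residual `σᵢᵢ - cᵢ` (`hessian_loss`).

Since `σ` is an orthogonal projection, its norm is at most `1` and its diagonal lies in `[0, 1]`;
with `c` in `[0, 1]` the residual has norm at most `1`. The operator norm is submultiplicative for
the Hadamard product too, so `‖B‖ ≤ 28`. As `J²` is positive semidefinite, weights of order `γ⁻²`
outweigh `B`, and the extra `l / σ_min²` yields `l I`.

The same bounds, applied to differences, make the Hessian Lipschitz with constant `624 ρ³` wherever
`‖A(x)‖ ≤ ρ` (`norm_hessian_sub_le`). Near a minimum where the Hessian is at least `l I`, a good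
initialization keeps all Hessians on the ball within `l / 10` of each other along radii. A Newton
step then divides the distance by at least `9` (`newtonStep_contract`), and `9 > e` gives the
logarithmic iteration count.

For the running time, the explicit formulas are evaluated with schoolbook arithmetic in `O(n³)`
instructions when `d ≤ n`. This fits the budget because a program multiplying `d × n` by `n × n`
must read all `n²` entries of the second factor, two per instruction at most: `n² ≤ 2 T_mat(d, n,
n)` (`mul_le_two_mul_Tmat`). Inverses are taken only of positive definite matrices, for which
pivoting without row exchanges never divides by zero. If `d > n` the Gram matrix is singular and
there is nothing to compute. -/

namespace LevInv

/-! ### Differentiation of scalar and matrix functions through explicit directional derivatives. -/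

section DirectionalCalculus

variable {E : Type*} [NormedAddCommGroup E] [NormedSpace ℝ E]

/-- `f` is Fréchet differentiable at `x` with directional derivatives `f'`. -/
def HasDir (f f' : E → ℝ) (x : E) : Prop :=
  ∃ L : E →L[ℝ] ℝ, HasFDerivAt f L x ∧ ∀ v, L v = f' v

variable {f g f' g' : E → ℝ} {x : E}

theorem HasDir.fderiv_apply (h : HasDir f f' x) (v : E) : fderiv ℝ f x v = f' v := by
  obtain ⟨L, h1, h2⟩ := h
  rw [h1.fderiv, h2]

theorem HasDir.differentiableAt (h : HasDir f f' x) : DifferentiableAt ℝ f x := by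
  obtain ⟨L, h1, _⟩ := h
  exact h1.differentiableAt

theorem hasDir_of_differentiableAt (h : DifferentiableAt ℝ f x) :
    HasDir f (fun v => fderiv ℝ f x v) x :=
  ⟨_, h.hasFDerivAt, fun _ => rfl⟩

theorem HasDir.unique (h : HasDir f f' x) (h' : HasDir f g' x) (v : E) : f' v = g' v := by
  rw [← h.fderiv_apply, h'.fderiv_apply]

theorem HasDir.congr (h : HasDir f f' x) (e : ∀ v, f' v = g' v) : HasDir f g' x := by
  obtain ⟨L, h1, h2⟩ := h
  exact ⟨L, h1, fun v => (h2 v).trans (e v)⟩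

theorem HasDir.congr_of_eventuallyEq (h : HasDir f f' x) (e : g =ᶠ[nhds x] f) :
    HasDir g f' x := by
  obtain ⟨L, h1, h2⟩ := h
  exact ⟨L, h1.congr_of_eventuallyEq e, h2⟩

theorem hasDir_const (a : ℝ) (x : E) : HasDir (fun _ => a) (fun _ => 0) x :=
  ⟨0, hasFDerivAt_const a x, fun _ => rfl⟩

theorem HasDir.add (hf : HasDir f f' x) (hg : HasDir g g' x) :
    HasDir (fun y => f y + g y) (fun v => f' v + g' v) x := by
  obtain ⟨L, h1, h2⟩ := hf
  obtain ⟨M, h3, h4⟩ := hg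
  exact ⟨L + M, h1.add h3, fun v => by simp [h2, h4]⟩

theorem HasDir.sub (hf : HasDir f f' x) (hg : HasDir g g' x) :
    HasDir (fun y => f y - g y) (fun v => f' v - g' v) x := by
  obtain ⟨L, h1, h2⟩ := hf
  obtain ⟨M, h3, h4⟩ := hg
  exact ⟨L - M, h1.sub h3, fun v => by simp [h2, h4]⟩

theorem HasDir.mul (hf : HasDir f f' x) (hg : HasDir g g' x) :
    HasDir (fun y => f y * g y) (fun v => f' v * g x + f x * g' v) x := by
  obtain ⟨L, h1, h2⟩ := hf
  obtain ⟨M, h3, h4⟩ := hg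
  exact ⟨_, h1.mul h3, fun v => by simp [h2, h4]; ring⟩

theorem HasDir.const_mul (a : ℝ) (hf : HasDir f f' x) :
    HasDir (fun y => a * f y) (fun v => a * f' v) x :=
  ((hasDir_const a x).mul hf).congr fun v => by ring

theorem HasDir.inv (hf : HasDir f f' x) (h0 : f x ≠ 0) :
    HasDir (fun y => (f y)⁻¹) (fun v => -(f' v) / f x ^ 2) x := by
  obtain ⟨L, h1, h2⟩ := hf
  exact ⟨_, (hasFDerivAt_inv h0).comp x h1, fun v => by simp [h2]; ring⟩

theorem HasDir.sum {ι : Type*} {s : Finset ι} {F F' : ι → E → ℝ}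
    (h : ∀ i, HasDir (F i) (F' i) x) :
    HasDir (fun y => ∑ i ∈ s, F i y) (fun v => ∑ i ∈ s, F' i v) x := by
  choose L h1 h2 using h
  exact ⟨∑ i ∈ s, L i, HasFDerivAt.fun_sum fun i _ => h1 i, fun v => by simp [h2]⟩

variable {l m n : Type*}

/-- Entrywise differentiability of a matrix valued function. -/
def MatHasDir (F F' : E → Matrix m n ℝ) (x : E) : Prop :=
  ∀ i j, HasDir (fun y => F y i j) (fun v => F' v i j) x

variable {F F' : E → Matrix m n ℝ}

theorem MatHasDir.congr {G' : E → Matrix m n ℝ} (h : MatHasDir F F' x) (e : ∀ v, F' v = G' v) :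
    MatHasDir F G' x := fun i j => (h i j).congr fun v => by rw [e]

theorem MatHasDir.mul [Fintype n] {G G' : E → Matrix n l ℝ} (hF : MatHasDir F F' x) (hG : MatHasDir G G' x) :
    MatHasDir (fun y => F y * G y) (fun v => F' v * G x + F x * G' v) x := by
  intro i j
  simp only [Matrix.mul_apply, Matrix.add_apply, ← Finset.sum_add_distrib]
  exact HasDir.sum fun k => (hF i k).mul (hG k j)

theorem MatHasDir.transpose (hF : MatHasDir F F' x) :
    MatHasDir (fun y => (F y)ᵀ) (fun v => (F' v)ᵀ) x := fun i j => hF j i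

theorem MatHasDir.hadamard {G G' : E → Matrix m n ℝ} (hF : MatHasDir F F' x)
    (hG : MatHasDir G G' x) :
    MatHasDir (fun y => F y ⊙ G y) (fun v => F' v ⊙ G x + F x ⊙ G' v) x :=
  fun i j => (hF i j).mul (hG i j)

theorem MatHasDir.sub {G G' : E → Matrix m n ℝ} (hF : MatHasDir F F' x) (hG : MatHasDir G G' x) :
    MatHasDir (fun y => F y - G y) (fun v => F' v - G' v) x :=
  fun i j => (hF i j).sub (hG i j)

theorem matHasDir_const (A : Matrix m n ℝ) (x : E) :
    MatHasDir (fun _ => A) (fun _ => 0) x := fun i j => hasDir_const (A i j) x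

variable [Fintype n] [DecidableEq n]

theorem differentiableAt_det {F : E → Matrix n n ℝ}
    (h : ∀ i j, DifferentiableAt ℝ (fun y => F y i j) x) :
    DifferentiableAt ℝ (fun y => (F y).det) x := by
  simp only [Matrix.det_apply']
  refine DifferentiableAt.fun_sum fun σ _ => DifferentiableAt.const_mul ?_ _
  exact (HasFDerivAt.finsetProd fun i _ => (h (σ i) i).hasFDerivAt).differentiableAt

/-- By Cramer's rule an entry of the inverse is a quotient of two determinants, both polynomial in
the entries. -/
theorem differentiableAt_inv_apply {F : E → Matrix n n ℝ}
    (h : ∀ i j, DifferentiableAt ℝ (fun y => F y i j) x) (h0 : (F x).det ≠ 0) (i j : n) :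
    DifferentiableAt ℝ (fun y => (F y)⁻¹ i j) x := by
  simp only [Matrix.inv_def, Matrix.smul_apply, Ring.inverse_eq_inv', smul_eq_mul,
    Matrix.adjugate_apply]
  refine ((differentiableAt_det h).inv h0).mul (differentiableAt_det fun a b => ?_)
  by_cases hab : a = j
  · subst hab; simp
  · simpa [Matrix.updateRow_ne hab] using h a b

/-- Cramer's rule supplies differentiability. The formula then follows by differentiating `F⁻¹ F =
1`, valid near `x`, and solving for the derivative of `F⁻¹`. -/
theorem MatHasDir.inv {F F' : E → Matrix n n ℝ} (hF : MatHasDir F F' x) (h0 : (F x).det ≠ 0) :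
    MatHasDir (fun y => (F y)⁻¹) (fun v => -((F x)⁻¹ * F' v * (F x)⁻¹)) x := by
  have hd : ∀ i j, DifferentiableAt ℝ (fun y => F y i j) x := fun i j => (hF i j).differentiableAt
  have hG : MatHasDir (fun y => (F y)⁻¹)
      (fun v => Matrix.of fun i j => fderiv ℝ (fun y => (F y)⁻¹ i j) x v) x :=
    fun i j => hasDir_of_differentiableAt (differentiableAt_inv_apply hd h0 i j)
  refine hG.congr fun v => ?_
  have hev : ∀ᶠ y in nhds x, (F y).det ≠ 0 :=
    (differentiableAt_det hd).continuousAt.eventually_ne h0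
  have h1 : MatHasDir (fun y => (F y)⁻¹ * F y) (fun _ => 0) x := fun i j =>
    (matHasDir_const (1 : Matrix n n ℝ) x i j).congr_of_eventuallyEq <| by
      filter_upwards [hev] with y hy
      rw [Matrix.nonsing_inv_mul _ (isUnit_iff_ne_zero.2 hy)]
  have h2 := hG.mul hF
  have h3 : ∀ X : Matrix n n ℝ, X * F x + (F x)⁻¹ * F' v = 0 → X = -((F x)⁻¹ * F' v * (F x)⁻¹) := by
    intro X hX
    have := congrArg (· * (F x)⁻¹) (eq_neg_of_add_eq_zero_left hX)
    simpa [Matrix.mul_assoc, Matrix.mul_nonsing_inv _ (isUnit_iff_ne_zero.2 h0)] using this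
  apply h3
  ext i j
  exact (h2 i j).unique (h1 i j) v

end DirectionalCalculus

/-! ### Gradient and Hessian of the regularized loss. -/

section Formulas

variable {n d : ℕ}

/-- The points where the leverage scores are defined. -/
def Regular (D : Data n d) (x : EuclideanSpace ℝ (Fin d)) : Prop :=
  (∀ i, s D x i ≠ 0) ∧ IsUnit ((Ax D x)ᵀ * Ax D x).det

/-- `σ ∘ σ - diag σ`, which is half of the Jacobian of the leverage scores in the directions
`A(x) v`. -/
def jac (σ : Matrix (Fin n) (Fin n) ℝ) : Matrix (Fin n) (Fin n) ℝ := σ ⊙ σ - 1 ⊙ σ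

/-- The residual `σᵢᵢ - cᵢ`, as a diagonal matrix. -/
def resid (D : Data n d) (σ : Matrix (Fin n) (Fin n) ℝ) : Matrix (Fin n) (Fin n) ℝ :=
  1 ⊙ σ - Matrix.diagonal D.c

/-- The indefinite part of the Hessian of the leverage score loss. -/
def indef (D : Data n d) (σ : Matrix (Fin n) (Fin n) ℝ) : Matrix (Fin n) (Fin n) ℝ :=
  (6 : ℝ) • ((1 ⊙ σ) * resid D σ) - (4 : ℝ) • (resid D σ * (σ ⊙ σ)) -
    (4 : ℝ) • ((σ ⊙ σ) * resid D σ) - (6 : ℝ) • (1 ⊙ (σ * resid D σ * σ)) +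
    (8 : ℝ) • (σ ⊙ (σ * resid D σ * σ))

/-- The Hessian of the regularized loss, as a function of `A(x)` and `σ(x)`. -/
def hessForm (D : Data n d) (X : Matrix (Fin n) (Fin d) ℝ) (σ : Matrix (Fin n) (Fin n) ℝ) :
    Matrix (Fin d) (Fin d) ℝ :=
  Xᵀ * ((4 : ℝ) • (jac σ * jac σ) + indef D σ) * X +
    D.Aᵀ * Matrix.diagonal (fun i => D.w i ^ 2) * D.A

/-- The directional derivative of the regularized loss. -/
noncomputable def dloss (D : Data n d) (x v : EuclideanSpace ℝ (Fin d)) : ℝ :=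
  2 * (fun i => lev D x i i - D.c i) ⬝ᵥ (jac (lev D x) *ᵥ (Ax D x *ᵥ v.ofLp)) +
    ∑ i, D.w i ^ 2 * ((D.A *ᵥ x.ofLp) i * (D.A *ᵥ v.ofLp) i)

variable {D : Data n d} {x : EuclideanSpace ℝ (Fin d)}

theorem Ax_apply (h : ∀ i, s D x i ≠ 0) (i : Fin n) (j : Fin d) :
    Ax D x i j = (s D x i)⁻¹ * D.A i j := by
  have h1 : (Matrix.diagonal (s D x))⁻¹ = Matrix.diagonal (fun i => (s D x i)⁻¹) := by
    apply Matrix.inv_eq_right_inv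
    rw [Matrix.diagonal_mul_diagonal]
    simp [h]
  rw [Ax, h1, Matrix.diagonal_mul]

theorem hasDir_coord (j : Fin d) (x : EuclideanSpace ℝ (Fin d)) :
    HasDir (fun y : EuclideanSpace ℝ (Fin d) => y.ofLp j) (fun v => v.ofLp j) x :=
  ⟨EuclideanSpace.proj j, (EuclideanSpace.proj j : EuclideanSpace ℝ (Fin d) →L[ℝ] ℝ).hasFDerivAt,
    fun _ => rfl⟩

theorem hasDir_mulVec (M : Matrix (Fin n) (Fin d) ℝ) (i : Fin n) (x : EuclideanSpace ℝ (Fin d)) :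
    HasDir (fun y : EuclideanSpace ℝ (Fin d) => (M *ᵥ y.ofLp) i) (fun v => (M *ᵥ v.ofLp) i) x :=
  HasDir.sum (s := Finset.univ) fun j => (hasDir_coord j x).const_mul (M i j)

theorem hasDir_s (i : Fin n) :
    HasDir (fun y => s D y i) (fun v => (D.A *ᵥ v.ofLp) i) x :=
  ((hasDir_mulVec D.A i x).sub (hasDir_const (D.b i) x)).congr fun v => by simp

theorem eventually_s_ne (h : ∀ i, s D x i ≠ 0) : ∀ᶠ y in nhds x, ∀ i, s D y i ≠ 0 :=
  Filter.eventually_all.2 fun i =>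
    (hasDir_s (D := D) (x := x) i).differentiableAt.continuousAt.eventually_ne (h i)

theorem Ax_mulVec (h : ∀ i, s D x i ≠ 0) (v : Fin d → ℝ) (i : Fin n) :
    (Ax D x *ᵥ v) i = (s D x i)⁻¹ * (D.A *ᵥ v) i := by
  simp only [Matrix.mulVec, dotProduct, Ax_apply h, Finset.mul_sum, mul_assoc]

theorem matHasDir_Ax (h : ∀ i, s D x i ≠ 0) :
    MatHasDir (Ax D) (fun v => -(Matrix.diagonal (Ax D x *ᵥ v.ofLp) * Ax D x)) x := by
  intro i j
  have h1 := ((hasDir_s (D := D) (x := x) i).inv (h i)).mul (hasDir_const (D.A i j) x)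
  refine (h1.congr_of_eventuallyEq ?_).congr fun v => ?_
  · filter_upwards [eventually_s_ne h] with y hy
    exact Ax_apply hy i j
  · change _ = -((Matrix.diagonal (Ax D x *ᵥ v.ofLp) * Ax D x) i j)
    rw [Matrix.diagonal_mul, Ax_mulVec h, Ax_apply h]
    ring

theorem matHasDir_gram (h : ∀ i, s D x i ≠ 0) :
    MatHasDir (fun y => (Ax D y)ᵀ * Ax D y)
      (fun v => -(2 : ℝ) • ((Ax D x)ᵀ * Matrix.diagonal (Ax D x *ᵥ v.ofLp) * Ax D x)) x :=
  ((matHasDir_Ax h).transpose.mul (matHasDir_Ax h)).congr fun v => by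
    simp only [Matrix.transpose_neg, Matrix.transpose_mul, Matrix.diagonal_transpose,
      Matrix.neg_mul, Matrix.mul_neg, Matrix.mul_assoc, neg_smul, two_smul]
    abel

/-- Product rule on `A(x) G⁻¹ A(x)ᵀ`: each outer factor contributes a one-sided term, and the Gram
inverse contributes the term with `σ` on both sides. -/
theorem matHasDir_lev (h : Regular D x) :
    MatHasDir (lev D) (fun v => (2 : ℝ) • (lev D x * Matrix.diagonal (Ax D x *ᵥ v.ofLp) * lev D x) -
      Matrix.diagonal (Ax D x *ᵥ v.ofLp) * lev D x -
      lev D x * Matrix.diagonal (Ax D x *ᵥ v.ofLp)) x := by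
  have hA := matHasDir_Ax h.1
  refine ((hA.mul ((matHasDir_gram h.1).inv (isUnit_iff_ne_zero.1 h.2))).mul hA.transpose).congr
    fun v => ?_
  simp only [lev, Matrix.transpose_neg, Matrix.transpose_mul, Matrix.diagonal_transpose,
    Matrix.neg_mul, Matrix.mul_neg, Matrix.mul_assoc, neg_smul, Matrix.add_mul, Matrix.mul_smul,
    Matrix.smul_mul, neg_neg]
  abel

theorem Regular.eventually (h : Regular D x) : ∀ᶠ y in nhds x, Regular D y := by
  have h1 : ∀ᶠ y in nhds x, ((Ax D y)ᵀ * Ax D y).det ≠ 0 :=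
    (differentiableAt_det fun i j =>
      (matHasDir_gram h.1 i j).differentiableAt).continuousAt.eventually_ne
      (isUnit_iff_ne_zero.1 h.2)
  filter_upwards [h1, eventually_s_ne h.1] with y h2 h3
  exact ⟨h3, isUnit_iff_ne_zero.2 h2⟩

theorem lev_transpose (D : Data n d) (x : EuclideanSpace ℝ (Fin d)) : (lev D x)ᵀ = lev D x := by
  simp [lev, Matrix.transpose_mul, Matrix.transpose_nonsing_inv, Matrix.mul_assoc]

theorem lev_symm (D : Data n d) (x : EuclideanSpace ℝ (Fin d)) (i j : Fin n) :
    lev D x i j = lev D x j i := by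
  conv_lhs => rw [← lev_transpose, Matrix.transpose_apply]

theorem jac_mulVec (σ : Matrix (Fin n) (Fin n) ℝ) (z : Fin n → ℝ) (i : Fin n) :
    (jac σ *ᵥ z) i = (∑ j, σ i j ^ 2 * z j) - σ i i * z i := by
  simp only [jac, Matrix.sub_mulVec, Pi.sub_apply, Matrix.one_hadamard, Matrix.mulVec_diagonal,
    Matrix.diag_apply]
  simp [Matrix.mulVec, dotProduct, pow_two]

theorem hasDir_lev_diag (h : Regular D x) (i : Fin n) :
    HasDir (fun y => lev D y i i)
      (fun v => 2 * (jac (lev D x) *ᵥ (Ax D x *ᵥ v.ofLp)) i) x := by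
  refine (matHasDir_lev h i i).congr fun v => ?_
  rw [jac_mulVec]
  set z := Ax D x *ᵥ v.ofLp
  simp only [Matrix.sub_apply, Matrix.smul_apply, smul_eq_mul, Matrix.mul_apply (M := _ * _),
    Matrix.mul_diagonal, Matrix.diagonal_mul]
  have : ∑ j, lev D x i j * z j * lev D x j i = ∑ j, lev D x i j ^ 2 * z j :=
    Finset.sum_congr rfl fun j _ => by rw [lev_symm D x j i]; ring
  rw [this]; ring

theorem Lreg_eq (D : Data n d) (x : EuclideanSpace ℝ (Fin d)) :
    Lreg D x = (1 / 2) * ∑ i, D.w i ^ 2 * ((D.A *ᵥ x.ofLp) i * (D.A *ᵥ x.ofLp) i) := by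
  rw [Lreg, EuclideanSpace.norm_sq_eq]
  congr 1
  refine Finset.sum_congr rfl fun i _ => ?_
  simp only [Real.norm_eq_abs, sq_abs, ← Matrix.mulVec_mulVec, Matrix.mulVec_diagonal]
  ring

theorem hasDir_loss (h : Regular D x) : HasDir (loss D) (dloss D x) x := by
  have h1 : HasDir (Lreg D) (fun v => ∑ i, D.w i ^ 2 * ((D.A *ᵥ x.ofLp) i * (D.A *ᵥ v.ofLp) i))
      x := by
    rw [show Lreg D = _ from funext (Lreg_eq D)]
    refine (HasDir.const_mul _ (HasDir.sum fun i => HasDir.const_mul _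
      ((hasDir_mulVec D.A i x).mul (hasDir_mulVec D.A i x)))).congr fun v => ?_
    rw [Finset.mul_sum]
    exact Finset.sum_congr rfl fun i _ => by ring
  have h2 : HasDir (Lexp D) (fun v => 2 * (fun i => lev D x i i - D.c i) ⬝ᵥ
      (jac (lev D x) *ᵥ (Ax D x *ᵥ v.ofLp))) x := by
    unfold Lexp
    simp only [pow_two]
    refine (HasDir.const_mul _ (HasDir.sum fun i =>
      ((hasDir_lev_diag h i).sub (hasDir_const (D.c i) x)).mul
      ((hasDir_lev_diag h i).sub (hasDir_const (D.c i) x)))).congr fun v => ?_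
    simp only [dotProduct, Finset.mul_sum]
    exact Finset.sum_congr rfl fun i _ => by ring
  exact h2.add h1

theorem jac_transpose {σ : Matrix (Fin n) (Fin n) ℝ} (hσ : σᵀ = σ) : (jac σ)ᵀ = jac σ := by
  simp [jac, Matrix.transpose_hadamard, hσ]

theorem resid_eq (D : Data n d) (σ : Matrix (Fin n) (Fin n) ℝ) :
    resid D σ = Matrix.diagonal fun i => σ i i - D.c i := by
  rw [resid, Matrix.one_hadamard, Matrix.diagonal_sub]
  rfl

/-- Expands the bilinear form with the residual factored out of every term. Where the residual sits
inside a product, the sums are interchanged and the symmetry of `σ` is used. -/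
theorem dotProduct_indef_mulVec (D : Data n d) {σ : Matrix (Fin n) (Fin n) ℝ} (hσ : σᵀ = σ)
    (z u : Fin n → ℝ) :
    z ⬝ᵥ (indef D σ *ᵥ u) = ∑ i, (σ i i - D.c i) *
      (6 * (σ i i * z i * u i) - 4 * (z i * ∑ j, σ i j ^ 2 * u j) -
        4 * (u i * ∑ j, σ i j ^ 2 * z j) - 6 * (∑ j, σ i j ^ 2 * (z j * u j)) +
        8 * ∑ j, σ i j * (∑ k, σ i k * z k * σ k j) * u j) := by
  have hs : ∀ i j, σ i j = σ j i := fun i j => by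
    conv_lhs => rw [← hσ, Matrix.transpose_apply]
  have e1 : z ⬝ᵥ (((1 ⊙ σ) * resid D σ) *ᵥ u) =
      ∑ i, (σ i i - D.c i) * (σ i i * z i * u i) := by
    rw [resid_eq, Matrix.one_hadamard, Matrix.diagonal_mul_diagonal]
    simp only [dotProduct, Matrix.mulVec_diagonal, Matrix.diag_apply]
    exact Finset.sum_congr rfl fun i _ => by ring
  have e2 : z ⬝ᵥ ((resid D σ * (σ ⊙ σ)) *ᵥ u) =
      ∑ i, (σ i i - D.c i) * (z i * ∑ j, σ i j ^ 2 * u j) := by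
    rw [resid_eq, ← Matrix.mulVec_mulVec]
    simp only [dotProduct, Matrix.mulVec_diagonal]
    refine Finset.sum_congr rfl fun i _ => ?_
    simp only [Matrix.mulVec, dotProduct, Matrix.hadamard_apply, ← pow_two]
    ring
  have e3 : z ⬝ᵥ (((σ ⊙ σ) * resid D σ) *ᵥ u) =
      ∑ i, (σ i i - D.c i) * (u i * ∑ j, σ i j ^ 2 * z j) := by
    rw [resid_eq, ← Matrix.mulVec_mulVec]
    simp only [Matrix.mulVec, dotProduct, Matrix.hadamard_apply, ← pow_two, Finset.mul_sum,
      Matrix.diagonal_apply, ite_mul, zero_mul, Finset.sum_ite_eq, Finset.mem_univ, if_true]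
    rw [Finset.sum_comm]
    refine Finset.sum_congr rfl fun i _ => Finset.sum_congr rfl fun j _ => ?_
    rw [hs i j]; ring
  have e0 : ∀ i j, (σ * resid D σ * σ) i j = ∑ k, σ i k * (σ k k - D.c k) * σ k j := fun i j => by
    simp only [resid_eq, Matrix.mul_apply (M := _ * _), Matrix.mul_diagonal]
  have e4 : z ⬝ᵥ ((1 ⊙ (σ * resid D σ * σ)) *ᵥ u) =
      ∑ i, (σ i i - D.c i) * (∑ j, σ i j ^ 2 * (z j * u j)) := by
    rw [Matrix.one_hadamard]
    simp only [dotProduct, Matrix.mulVec_diagonal, Matrix.diag_apply, e0, Finset.mul_sum,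
      Finset.sum_mul]
    rw [Finset.sum_comm]
    refine Finset.sum_congr rfl fun i _ => Finset.sum_congr rfl fun j _ => ?_
    rw [hs j i]; ring
  have e5 : z ⬝ᵥ ((σ ⊙ (σ * resid D σ * σ)) *ᵥ u) =
      ∑ i, (σ i i - D.c i) * (∑ j, σ i j * (∑ k, σ i k * z k * σ k j) * u j) := by
    simp only [Matrix.mulVec, dotProduct, Matrix.hadamard_apply, e0, Finset.mul_sum,
      Finset.sum_mul]
    rw [Finset.sum_congr rfl fun i _ => Finset.sum_comm, Finset.sum_comm,
      Finset.sum_congr rfl fun i _ => Finset.sum_comm]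
    refine Finset.sum_congr rfl fun i _ => Finset.sum_congr rfl fun j _ =>
      Finset.sum_congr rfl fun k _ => ?_
    rw [hs k i]; ring
  simp only [indef, Matrix.add_mulVec, Matrix.sub_mulVec, Matrix.smul_mulVec, dotProduct_add,
    dotProduct_sub, dotProduct_smul, e1, e2, e3, e4, e5, smul_eq_mul]
  rw [Finset.mul_sum, Finset.mul_sum, Finset.mul_sum, Finset.mul_sum, Finset.mul_sum,
    ← Finset.sum_sub_distrib, ← Finset.sum_sub_distrib, ← Finset.sum_sub_distrib,
    ← Finset.sum_add_distrib]
  exact Finset.sum_congr rfl fun i _ => by ring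

/-- The left side is what the product rule yields for the derivative of `2 ∑ (σᵢᵢ - cᵢ) (J u)ᵢ`: the
residual varies by `2 J z`, `σ` by `2 σ Z σ - Z σ - σ Z`, and `u = A(x) v` by `-z ∘ u`. Varying the
residual gives the semidefinite part `4 J²`; the rest is `indef`. -/
theorem second_variation (D : Data n d) {σ : Matrix (Fin n) (Fin n) ℝ} (hσ : σᵀ = σ)
    (z u : Fin n → ℝ) :
    2 * ((∑ i, (2 * (jac σ *ᵥ z) i) * (jac σ *ᵥ u) i) +
      ∑ i, (σ i i - D.c i) * (2 * ((σ ⊙ ((2 : ℝ) • (σ * Matrix.diagonal z * σ) -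
          Matrix.diagonal z * σ - σ * Matrix.diagonal z)) *ᵥ u) i - 2 * (jac σ *ᵥ z) i * u i -
        (jac σ *ᵥ fun j => z j * u j) i)) =
      z ⬝ᵥ (((4 : ℝ) • (jac σ * jac σ) + indef D σ) *ᵥ u) := by
  have e1 : z ⬝ᵥ ((jac σ * jac σ) *ᵥ u) = ∑ i, (jac σ *ᵥ z) i * (jac σ *ᵥ u) i := by
    rw [← Matrix.mulVec_mulVec, Matrix.dotProduct_mulVec, ← Matrix.mulVec_transpose,
      jac_transpose hσ]
    rfl
  have e2 : ∀ i, ((σ ⊙ ((2 : ℝ) • (σ * Matrix.diagonal z * σ) -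
      Matrix.diagonal z * σ - σ * Matrix.diagonal z)) *ᵥ u) i =
      2 * (∑ j, σ i j * (∑ k, σ i k * z k * σ k j) * u j) - (z i * ∑ j, σ i j ^ 2 * u j) -
        (∑ j, σ i j ^ 2 * (z j * u j)) := by
    intro i
    simp only [Matrix.mulVec, dotProduct, Matrix.hadamard_apply, Matrix.sub_apply,
      Matrix.smul_apply, smul_eq_mul, Matrix.mul_apply (M := _ * _), Matrix.mul_diagonal,
      Matrix.diagonal_mul]
    rw [Finset.mul_sum, Finset.mul_sum, ← Finset.sum_sub_distrib, ← Finset.sum_sub_distrib]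
    exact Finset.sum_congr rfl fun j _ => by ring
  rw [Matrix.add_mulVec, dotProduct_add, Matrix.smul_mulVec, dotProduct_smul, e1,
    dotProduct_indef_mulVec D hσ, mul_add, smul_eq_mul]
  congr 1
  · rw [Finset.mul_sum, Finset.mul_sum]
    exact Finset.sum_congr rfl fun i _ => by ring
  · rw [Finset.mul_sum]
    refine Finset.sum_congr rfl fun i _ => ?_
    rw [e2, jac_mulVec, jac_mulVec]
    ring

/-- Here `τ` stands for the variation of `σ`; its diagonal is already known from the derivative of
the leverage scores. -/
theorem sum_jac_variation (σ τ : Matrix (Fin n) (Fin n) ℝ) (z u : Fin n → ℝ) (i : Fin n)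
    (h : τ i i = 2 * (jac σ *ᵥ z) i) :
    ∑ j, ((τ ⊙ σ + σ ⊙ τ - ((0 : Matrix (Fin n) (Fin n) ℝ) ⊙ σ + 1 ⊙ τ)) i j * u j +
      (σ ⊙ σ - 1 ⊙ σ) i j * -(z j * u j)) =
    2 * ((σ ⊙ τ) *ᵥ u) i - 2 * (jac σ *ᵥ z) i * u i - (jac σ *ᵥ fun j => z j * u j) i := by
  have h1 : ∑ j, (1 ⊙ τ) i j * u j = τ i i * u i := by
    simp [Matrix.hadamard_apply, Matrix.one_apply]
  rw [← h, ← h1]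
  simp only [Matrix.mulVec, dotProduct, jac, Finset.mul_sum, ← Finset.sum_sub_distrib]
  refine Finset.sum_congr rfl fun j _ => ?_
  simp only [Matrix.sub_apply, Matrix.add_apply, Matrix.hadamard_apply, Matrix.zero_apply]
  ring

theorem hasDir_dloss (h : Regular D x) (v : EuclideanSpace ℝ (Fin d)) :
    HasDir (fun y => dloss D y v) (fun z => z.ofLp ⬝ᵥ (hessForm D (Ax D x) (lev D x) *ᵥ v.ofLp))
      x := by
  have hσ := matHasDir_lev h
  have hone := matHasDir_const (1 : Matrix (Fin n) (Fin n) ℝ) x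
  have hu : ∀ j, HasDir (fun y => (Ax D y *ᵥ v.ofLp) j)
      (fun z => -((Ax D x *ᵥ z.ofLp) j * (Ax D x *ᵥ v.ofLp) j)) x := fun j =>
    (HasDir.sum (s := Finset.univ) fun k =>
      (matHasDir_Ax h.1 j k).mul (hasDir_const (v.ofLp k) x)).congr fun z => by
        simp only [Matrix.neg_apply, Matrix.diagonal_mul, mul_zero, add_zero]
        simp only [Matrix.mulVec, dotProduct, Finset.mul_sum, neg_mul, Finset.sum_neg_distrib,
          mul_assoc]
  have hJ := (hσ.hadamard hσ).sub (hone.hadamard hσ)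
  have h1 : HasDir (fun y => 2 * (fun i => lev D y i i - D.c i) ⬝ᵥ
      (jac (lev D y) *ᵥ (Ax D y *ᵥ v.ofLp))) (fun z => (Ax D x *ᵥ z.ofLp) ⬝ᵥ
        (((4 : ℝ) • (jac (lev D x) * jac (lev D x)) + indef D (lev D x)) *ᵥ
          (Ax D x *ᵥ v.ofLp))) x := by
    refine (HasDir.const_mul 2 (HasDir.sum (s := Finset.univ) fun i =>
      ((hasDir_lev_diag h i).sub (hasDir_const (D.c i) x)).mul
        (HasDir.sum (s := Finset.univ) fun j => (hJ i j).mul (hu j)))).congr fun z => ?_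
    rw [← second_variation D (lev_transpose D x), ← Finset.sum_add_distrib]
    congr 1
    refine Finset.sum_congr rfl fun i _ => ?_
    have hd := (matHasDir_lev h i i).unique (hasDir_lev_diag h i) z
    rw [sub_zero]
    congr 2
    exact sum_jac_variation _ _ _ _ _ hd
  have h2 : HasDir (fun y : EuclideanSpace ℝ (Fin d) =>
      ∑ i, D.w i ^ 2 * ((D.A *ᵥ y.ofLp) i * (D.A *ᵥ v.ofLp) i))
      (fun z => (D.A *ᵥ z.ofLp) ⬝ᵥ (Matrix.diagonal (fun i => D.w i ^ 2) *ᵥ (D.A *ᵥ v.ofLp))) x := by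
    refine (HasDir.sum (s := Finset.univ) fun i => HasDir.const_mul _
      ((hasDir_mulVec D.A i x).mul (hasDir_const _ x))).congr fun z => ?_
    simp only [dotProduct, Matrix.mulVec_diagonal]
    exact Finset.sum_congr rfl fun i _ => by ring
  refine (h1.add h2).congr fun z => ?_
  simp only [hessForm, Matrix.add_mulVec, dotProduct_add, ← Matrix.mulVec_mulVec,
    Matrix.dotProduct_mulVec _ (Matrix.transpose _), Matrix.vecMul_transpose]

/-- Regularity is an open condition, so the formula for the first derivative holds on a
neighbourhood and may be differentiated again. -/
theorem hessian_loss (h : Regular D x) :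
    hessian (loss D) x = hessForm D (Ax D x) (lev D x) := by
  ext k j
  have h1 : HasDir (fun y => fderiv ℝ (loss D) y (EuclideanSpace.single j 1)) _ x :=
    (hasDir_dloss h (EuclideanSpace.single j 1)).congr_of_eventuallyEq <| by
      filter_upwards [h.eventually] with y hy
      exact (hasDir_loss hy).fderiv_apply _
  rw [hessian, Matrix.of_apply, h1.fderiv_apply]
  simp

theorem hasDir_fderiv_loss (h : Regular D x) (v : EuclideanSpace ℝ (Fin d)) :
    HasDir (fun y => fderiv ℝ (loss D) y v)
      (fun z => z.ofLp ⬝ᵥ (hessian (loss D) x *ᵥ v.ofLp)) x := by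
  rw [hessian_loss h]
  refine (hasDir_dloss h v).congr_of_eventuallyEq ?_
  filter_upwards [h.eventually] with y hy
  exact (hasDir_loss hy).fderiv_apply _

theorem fderiv_eq_dotProduct (f : EuclideanSpace ℝ (Fin d) → ℝ) (x v : EuclideanSpace ℝ (Fin d)) :
    fderiv ℝ f x v = (gradient f x).ofLp ⬝ᵥ v.ofLp := by
  have h := InnerProductSpace.toDual_symm_apply (𝕜 := ℝ) (x := v) (y := fderiv ℝ f x)
  change inner ℝ (gradient f x) v = _ at h
  rw [← h, PiLp.inner_apply]
  simp only [RCLike.inner_apply, conj_trivial, dotProduct, mul_comm]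

theorem gradient_apply (f : EuclideanSpace ℝ (Fin d) → ℝ) (x : EuclideanSpace ℝ (Fin d))
    (j : Fin d) : (gradient f x).ofLp j = fderiv ℝ f x (EuclideanSpace.single j 1) := by
  rw [fderiv_eq_dotProduct]
  simp

end Formulas
-- Spectral norm estimates, Hadamard products and the smallest singular value.
section OperatorNorm

open scoped Matrix.Norms.L2Operator

variable {m n k : ℕ}

/-- The Euclidean norm of a vector. -/
noncomputable def l2 (v : Fin n → ℝ) : ℝ := ‖WithLp.toLp 2 v‖

theorem l2_nonneg (v : Fin n → ℝ) : 0 ≤ l2 v := norm_nonneg _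

theorem l2_sq (v : Fin n → ℝ) : l2 v ^ 2 = ∑ i, v i ^ 2 := by
  simp [l2, EuclideanSpace.norm_sq_eq]

theorem l2_ofLp (v : EuclideanSpace ℝ (Fin n)) : l2 v.ofLp = ‖v‖ := rfl

theorem dotProduct_self_eq (v : Fin n → ℝ) : v ⬝ᵥ v = l2 v ^ 2 := by
  rw [l2_sq]
  simp [dotProduct, pow_two]

theorem abs_dotProduct_le (u v : Fin n → ℝ) : |u ⬝ᵥ v| ≤ l2 u * l2 v := by
  have h := abs_real_inner_le_norm (WithLp.toLp 2 v) (WithLp.toLp 2 u)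
  rw [PiLp.inner_apply] at h
  simp only [RCLike.inner_apply, conj_trivial] at h
  rw [mul_comm] at h
  exact h

theorem l2_mulVec_le (A : Matrix (Fin m) (Fin n) ℝ) (v : Fin n → ℝ) : l2 (A *ᵥ v) ≤ ‖A‖ * l2 v :=
  Matrix.l2_opNorm_mulVec A (WithLp.toLp 2 v)

theorem abs_dotProduct_mulVec_le (A : Matrix (Fin m) (Fin n) ℝ) (u : Fin m → ℝ) (v : Fin n → ℝ) :
    |u ⬝ᵥ (A *ᵥ v)| ≤ ‖A‖ * (l2 u * l2 v) :=
  (abs_dotProduct_le _ _).trans <|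
    (mul_le_mul_of_nonneg_left (l2_mulVec_le A v) (l2_nonneg u)).trans_eq (by ring)

theorem l2_le_of_dotProduct_le {v : Fin n → ℝ} {C : ℝ} (hC : 0 ≤ C)
    (h : ∀ u, u ⬝ᵥ v ≤ C * l2 u) : l2 v ≤ C := by
  have h1 := h v
  rw [dotProduct_self_eq] at h1
  nlinarith [l2_nonneg v]

theorem opNorm_le_of_forall {A : Matrix (Fin m) (Fin n) ℝ} {C : ℝ} (hC : 0 ≤ C)
    (h : ∀ u v, u ⬝ᵥ (A *ᵥ v) ≤ C * (l2 u * l2 v)) : ‖A‖ ≤ C := by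
  rw [Matrix.l2_opNorm_def]
  refine ContinuousLinearMap.opNorm_le_bound _ hC fun v => ?_
  change l2 (A *ᵥ v.ofLp) ≤ C * l2 v.ofLp
  refine l2_le_of_dotProduct_le (mul_nonneg hC (l2_nonneg _)) fun u => (h u v.ofLp).trans_eq (by ring)

theorem opNorm_transpose (A : Matrix (Fin m) (Fin n) ℝ) : ‖Aᵀ‖ = ‖A‖ := by
  rw [← Matrix.conjTranspose_eq_transpose_of_trivial, Matrix.l2_opNorm_conjTranspose]

theorem sum_sq_col_le (A : Matrix (Fin m) (Fin n) ℝ) (j : Fin n) : ∑ i, A i j ^ 2 ≤ ‖A‖ ^ 2 := by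
  have h := l2_mulVec_le A (Pi.single j 1)
  have h1 : l2 (Pi.single j (1 : ℝ) : Fin n → ℝ) = 1 := by
    have := PiLp.norm_single 2 (fun _ : Fin n => ℝ) j (1 : ℝ)
    rwa [norm_one] at this
  rw [h1, mul_one] at h
  have h2 := pow_le_pow_left₀ (l2_nonneg _) h 2
  rw [l2_sq] at h2
  simpa using h2

theorem sum_sq_row_le (A : Matrix (Fin m) (Fin n) ℝ) (i : Fin m) : ∑ j, A i j ^ 2 ≤ ‖A‖ ^ 2 := by
  simpa [opNorm_transpose] using sum_sq_col_le Aᵀ i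

/-- Cauchy–Schwarz over pairs `(i, j)`, splitting `Xᵢⱼ Yᵢⱼ uᵢ vⱼ` as `(Xᵢⱼ uᵢ)(Yᵢⱼ vⱼ)`: the rows of
`X` and the columns of `Y` have Euclidean norm at most the operator norm. -/
theorem opNorm_hadamard_le (X Y : Matrix (Fin m) (Fin n) ℝ) : ‖X ⊙ Y‖ ≤ ‖X‖ * ‖Y‖ := by
  refine opNorm_le_of_forall (by positivity) fun u v => ?_
  have h1 : u ⬝ᵥ ((X ⊙ Y) *ᵥ v) = ∑ p : Fin m × Fin n, (X p.1 p.2 * u p.1) * (Y p.1 p.2 * v p.2) := by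
    rw [Fintype.sum_prod_type]
    simp only [dotProduct, Matrix.mulVec, Finset.mul_sum, Matrix.hadamard_apply]
    exact Finset.sum_congr rfl fun i _ => Finset.sum_congr rfl fun j _ => by ring
  have h2 : ∑ p : Fin m × Fin n, (X p.1 p.2 * u p.1) ^ 2 ≤ (‖X‖ * l2 u) ^ 2 := by
    rw [Fintype.sum_prod_type, mul_pow, l2_sq, Finset.mul_sum]
    refine Finset.sum_le_sum fun i _ => ?_
    simp only [mul_pow, ← Finset.sum_mul]
    exact mul_le_mul_of_nonneg_right (sum_sq_row_le X i) (sq_nonneg _)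
  have h3 : ∑ p : Fin m × Fin n, (Y p.1 p.2 * v p.2) ^ 2 ≤ (‖Y‖ * l2 v) ^ 2 := by
    rw [Fintype.sum_prod_type_right, mul_pow, l2_sq, Finset.mul_sum]
    refine Finset.sum_le_sum fun i _ => ?_
    simp only [mul_pow, ← Finset.sum_mul]
    exact mul_le_mul_of_nonneg_right (sum_sq_col_le Y i) (sq_nonneg _)
  have h4 := Finset.sum_mul_sq_le_sq_mul_sq Finset.univ
    (fun p : Fin m × Fin n => X p.1 p.2 * u p.1) (fun p => Y p.1 p.2 * v p.2)
  rw [h1]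
  refine le_of_sq_le_sq (h4.trans ((mul_le_mul h2 h3 (Finset.sum_nonneg fun _ _ => sq_nonneg _)
    (sq_nonneg _)).trans_eq (by ring))) ?_
  have := l2_nonneg u
  have := l2_nonneg v
  positivity

/-- The C*-identity gives `‖P‖ = ‖P‖²`. -/
theorem opNorm_le_one_of_projection {P : Matrix (Fin n) (Fin n) ℝ} (h1 : Pᵀ = P) (h2 : P * P = P) :
    ‖P‖ ≤ 1 := by
  have h := Matrix.l2_opNorm_conjTranspose_mul_self P
  rw [Matrix.conjTranspose_eq_transpose_of_trivial, h1, h2] at h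
  by_contra! h3
  nlinarith

/-- In an orthonormal eigenbasis of `AᵀA`, `‖A v‖²` is the sum of the squared coordinates of `v`
weighted by eigenvalues, and the last eigenvalue, the square of `sigmaMin A`, is the smallest. -/
theorem sigmaMin_mul_le (A : Matrix (Fin n) (Fin m) ℝ) (v : Fin m → ℝ) :
    sigmaMin A * l2 v ≤ l2 (A *ᵥ v) := by
  -- For `m = 0` the index `m - 1` truncates to `0` and is no eigenvalue index; but then `v` is
  -- empty.
  rcases Nat.eq_zero_or_pos m with rfl | hm
  · have : l2 v = 0 := by rw [← sq_eq_zero_iff, l2_sq]; simp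
    rw [this, mul_zero]
    exact l2_nonneg _
  set T := Matrix.toEuclideanLin A
  have hd : Module.finrank ℝ (EuclideanSpace ℝ (Fin m)) = m := by simp
  have hS := T.isSymmetric_adjoint_comp_self
  have h1 : sigmaMin A ^ 2 = hS.eigenvalues hd ⟨m - 1, by omega⟩ :=
    T.sq_singularValues_of_lt hd (by omega)
  set x := WithLp.toLp 2 v
  have h2 : ‖T x‖ ^ 2 = ∑ i, hS.eigenvalues hd i * (inner ℝ (hS.eigenvectorBasis hd i) x) ^ 2 := by
    rw [← real_inner_self_eq_norm_sq, ← LinearMap.adjoint_inner_right,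
      ← (hS.eigenvectorBasis hd).sum_inner_mul_inner]
    refine Finset.sum_congr rfl fun i _ => ?_
    have := hS.apply_eigenvectorBasis hd i
    rw [← LinearMap.comp_apply, ← hS (hS.eigenvectorBasis hd i) x, this]
    simp [inner_smul_left, real_inner_comm]
    ring
  have h3 : ‖x‖ ^ 2 = ∑ i, (inner ℝ (hS.eigenvectorBasis hd i) x) ^ 2 := by
    rw [← (hS.eigenvectorBasis hd).sum_sq_norm_inner_right x]
    simp
  refine le_of_sq_le_sq ?_ (l2_nonneg _)
  change (sigmaMin A * ‖x‖) ^ 2 ≤ ‖T x‖ ^ 2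
  rw [mul_pow, h1, h2, h3, Finset.mul_sum]
  refine Finset.sum_le_sum fun i _ => mul_le_mul_of_nonneg_right ?_ (sq_nonneg _)
  exact hS.eigenvalues_antitone hd (Fin.le_def.2 (by simp; omega))

/-- Two matrices of norm at most `a` at distance at most `r`. -/
def Near (a r : ℝ) (X Y : Matrix (Fin m) (Fin n) ℝ) : Prop :=
  ‖X‖ ≤ a ∧ ‖Y‖ ≤ a ∧ ‖X - Y‖ ≤ r

variable {a b r t : ℝ} {X Y X' Y' : Matrix (Fin m) (Fin n) ℝ}

theorem Near.add (h : Near a r X Y) (h' : Near b t X' Y') : Near (a + b) (r + t) (X + X') (Y + Y') := by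
  obtain ⟨h1, h2, h3⟩ := h
  obtain ⟨h4, h5, h6⟩ := h'
  refine ⟨norm_add_le_of_le h1 h4, norm_add_le_of_le h2 h5, ?_⟩
  rw [add_sub_add_comm]
  exact norm_add_le_of_le h3 h6

theorem Near.sub (h : Near a r X Y) (h' : Near b t X' Y') : Near (a + b) (r + t) (X - X') (Y - Y') := by
  obtain ⟨h1, h2, h3⟩ := h
  obtain ⟨h4, h5, h6⟩ := h'
  refine ⟨norm_sub_le_of_le h1 h4, norm_sub_le_of_le h2 h5, ?_⟩
  rw [sub_sub_sub_comm]
  exact norm_sub_le_of_le h3 h6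

theorem Near.smul {c : ℝ} (hc : 0 ≤ c) (h : Near a r X Y) : Near (c * a) (c * r) (c • X) (c • Y) := by
  obtain ⟨h1, h2, h3⟩ := h
  simp only [Near, ← smul_sub, norm_smul, Real.norm_of_nonneg hc]
  exact ⟨by gcongr, by gcongr, by gcongr⟩

theorem Near.transpose (h : Near a r X Y) : Near a r Xᵀ Yᵀ := by
  simpa only [Near, ← Matrix.transpose_sub, opNorm_transpose] using h

/-- Telescoping: `X X' - Y Y' = (X - Y) X' + Y (X' - Y')`. Together with its companions this turns
Lipschitz bounds for polynomial expressions into bookkeeping of constants. -/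
theorem Near.mul {X' Y' : Matrix (Fin n) (Fin k) ℝ} (h : Near a r X Y) (h' : Near b t X' Y') :
    Near (a * b) (r * b + a * t) (X * X') (Y * Y') := by
  obtain ⟨h1, h2, h3⟩ := h
  obtain ⟨h4, h5, h6⟩ := h'
  have ha : 0 ≤ a := (norm_nonneg _).trans h1
  have hr : 0 ≤ r := (norm_nonneg _).trans h3
  refine ⟨(Matrix.l2_opNorm_mul _ _).trans (by gcongr), (Matrix.l2_opNorm_mul _ _).trans (by gcongr),
    ?_⟩
  rw [show X * X' - Y * Y' = (X - Y) * X' + Y * (X' - Y') by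
    rw [Matrix.sub_mul, Matrix.mul_sub]; abel]
  exact norm_add_le_of_le ((Matrix.l2_opNorm_mul _ _).trans (by gcongr))
    ((Matrix.l2_opNorm_mul _ _).trans (by gcongr))

theorem Near.hadamard (h : Near a r X Y) (h' : Near b t X' Y') :
    Near (a * b) (r * b + a * t) (X ⊙ X') (Y ⊙ Y') := by
  obtain ⟨h1, h2, h3⟩ := h
  obtain ⟨h4, h5, h6⟩ := h'
  have ha : 0 ≤ a := (norm_nonneg _).trans h1
  have hr : 0 ≤ r := (norm_nonneg _).trans h3
  refine ⟨(opNorm_hadamard_le _ _).trans (by gcongr), (opNorm_hadamard_le _ _).trans (by gcongr), ?_⟩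
  rw [show X ⊙ X' - Y ⊙ Y' = (X - Y) ⊙ X' + Y ⊙ (X' - Y') by
    ext i j; simp only [Matrix.sub_apply, Matrix.add_apply, Matrix.hadamard_apply]; ring]
  exact norm_add_le_of_le ((opNorm_hadamard_le _ _).trans (by gcongr))
    ((opNorm_hadamard_le _ _).trans (by gcongr))

theorem near_refl (h : ‖X‖ ≤ a) : Near a 0 X X := ⟨h, h, by simp⟩

end OperatorNorm

/-! ### Mean value inequalities along a segment. -/

section MeanValue

open scoped Matrix.Norms.L2Operator

theorem HasDir.abs_sub_le {E : Type*} [NormedAddCommGroup E] [NormedSpace ℝ E] {f : E → ℝ}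
    {f' : ℝ → E → ℝ} {a e : E} {C : ℝ}
    (h : ∀ t ∈ Set.Icc (0 : ℝ) 1, HasDir f (f' t) (a + t • e))
    (hC : ∀ t ∈ Set.Icc (0 : ℝ) 1, |f' t e| ≤ C) : |f (a + e) - f a| ≤ C := by
  have h1 : ∀ t ∈ Set.Icc (0 : ℝ) 1, HasDerivWithinAt (fun t : ℝ => f (a + t • e)) (f' t e)
      (Set.Icc 0 1) t := by
    intro t ht
    obtain ⟨L, hL, hv⟩ := h t ht
    rw [← hv]
    have h2 : HasDerivAt (fun t : ℝ => a + t • e) e t := by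
      simpa using ((hasDerivAt_id t).smul_const e).const_add a
    exact (hL.comp_hasDerivAt t h2).hasDerivWithinAt
  simpa using norm_image_sub_le_of_norm_deriv_le_segment_01' h1
    fun t ht => hC t ⟨ht.1, ht.2.le⟩

/-- Reduction to scalars by pairing with fixed vectors: the bound for `uᵀ F v` is uniform in `u` and
`v`, hence bounds the operator norm. -/
theorem MatHasDir.norm_sub_le {E : Type*} [NormedAddCommGroup E] [NormedSpace ℝ E] {m n : ℕ}
    {F : E → Matrix (Fin m) (Fin n) ℝ} {F' : ℝ → E → Matrix (Fin m) (Fin n) ℝ} {a e : E} {C : ℝ}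
    (h : ∀ t ∈ Set.Icc (0 : ℝ) 1, MatHasDir F (F' t) (a + t • e))
    (hC : ∀ t ∈ Set.Icc (0 : ℝ) 1, ‖F' t e‖ ≤ C) : ‖F (a + e) - F a‖ ≤ C := by
  refine opNorm_le_of_forall ((norm_nonneg _).trans (hC 0 (by simp))) fun u v => ?_
  rw [Matrix.sub_mulVec, dotProduct_sub]
  refine (le_abs_self _).trans (HasDir.abs_sub_le (f := fun y => u ⬝ᵥ (F y *ᵥ v))
    (f' := fun t y => u ⬝ᵥ (F' t y *ᵥ v)) (fun t ht => ?_) fun t ht => ?_)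
  · refine (HasDir.sum (s := Finset.univ) fun i => HasDir.const_mul (u i)
      (HasDir.sum (s := Finset.univ) fun j =>
        (h t ht i j).mul (hasDir_const (v j) _))).congr fun w => ?_
    simp [dotProduct, Matrix.mulVec]
  · refine (abs_dotProduct_mulVec_le _ _ _).trans ?_
    have := l2_nonneg u
    have := l2_nonneg v
    exact mul_le_mul_of_nonneg_right (hC t ht) (by positivity)

end MeanValue

/-! ### Bounds on leverage matrices, positive definiteness and Lipschitz continuity of the Hessian.
-/

section LeverageBounds

open scoped Matrix.Norms.L2Operator

variable {n d : ℕ} {D : Data n d} {x : EuclideanSpace ℝ (Fin d)}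

theorem lev_mul_lev (h : IsUnit ((Ax D x)ᵀ * Ax D x).det) : lev D x * lev D x = lev D x := by
  simp only [lev, Matrix.mul_assoc]
  rw [← Matrix.mul_assoc (Ax D x)ᵀ (Ax D x), Matrix.mul_nonsing_inv_cancel_left _ _ h]

theorem opNorm_lev_le (h : IsUnit ((Ax D x)ᵀ * Ax D x).det) : ‖lev D x‖ ≤ 1 :=
  opNorm_le_one_of_projection (lev_transpose D x) (lev_mul_lev h)

/-- Since `σ` is symmetric and idempotent, `σᵢᵢ` is the squared norm of the `i`-th row. -/
theorem lev_diag_mem (h : IsUnit ((Ax D x)ᵀ * Ax D x).det) (i : Fin n) :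
    lev D x i i ∈ Set.Icc (0 : ℝ) 1 := by
  have h1 : lev D x i i = ∑ j, lev D x i j ^ 2 := by
    conv_lhs => rw [← lev_mul_lev h, Matrix.mul_apply]
    exact Finset.sum_congr rfl fun j _ => by rw [lev_symm D x j i, pow_two]
  rw [h1]
  refine ⟨Finset.sum_nonneg fun _ _ => sq_nonneg _, (sum_sq_row_le _ i).trans ?_⟩
  exact pow_le_one₀ (norm_nonneg _) (opNorm_lev_le h)

theorem opNorm_resid_le (hc : ∀ i, 0 ≤ D.c i ∧ D.c i ≤ 1)
    (h : IsUnit ((Ax D x)ᵀ * Ax D x).det) : ‖resid D (lev D x)‖ ≤ 1 := by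
  rw [resid_eq, Matrix.l2_opNorm_diagonal, pi_norm_le_iff_of_nonneg zero_le_one]
  intro i
  have h1 := lev_diag_mem h i
  have h2 := hc i
  rw [Real.norm_eq_abs, abs_le]
  constructor <;> linarith [h1.1, h1.2, h2.1, h2.2]

/-- All the matrices that enter the Hessian of the leverage score loss, at two points whose
leverage score matrices are at distance at most `δ`. -/
theorem near_indef (hc : ∀ i, 0 ≤ D.c i ∧ D.c i ≤ 1) {y : EuclideanSpace ℝ (Fin d)}
    (hx : IsUnit ((Ax D x)ᵀ * Ax D x).det) (hy : IsUnit ((Ax D y)ᵀ * Ax D y).det) {δ : ℝ}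
    (h : ‖lev D x - lev D y‖ ≤ δ) :
    Near 2 (3 * δ) (jac (lev D x)) (jac (lev D y)) ∧
    Near 28 (86 * δ) (indef D (lev D x)) (indef D (lev D y)) := by
  have hσ : Near 1 δ (lev D x) (lev D y) := ⟨opNorm_lev_le hx, opNorm_lev_le hy, h⟩
  have hone : Near 1 0 (1 : Matrix (Fin n) (Fin n) ℝ) 1 :=
    near_refl (opNorm_le_one_of_projection (by simp) (by simp))
  have hd := hone.hadamard hσ
  have hr : Near 1 δ (resid D (lev D x)) (resid D (lev D y)) := by
    refine ⟨opNorm_resid_le hc hx, opNorm_resid_le hc hy, ?_⟩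
    rw [resid, resid, sub_sub_sub_cancel_right]
    simpa using hd.2.2
  have hq := hσ.hadamard hσ
  have hσr := (hσ.mul hr).mul hσ
  have hJ := hq.sub hd
  -- The norm bound is `6 + 4 + 4 + 6 + 8 = 28`. The five terms have `2, 3, 3, 3, 4` factors that
  -- vary by `δ`, so the distance is `(12 + 12 + 12 + 18 + 32) δ = 86 δ`.
  have hI := (((((hd.mul hr).smul (c := 6) (by norm_num)).sub
    ((hr.mul hq).smul (c := 4) (by norm_num))).sub ((hq.mul hr).smul (c := 4) (by norm_num))).sub
    ((hone.hadamard hσr).smul (c := 6) (by norm_num))).add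
    ((hσ.hadamard hσr).smul (c := 8) (by norm_num))
  ring_nf at hJ hI ⊢
  exact ⟨hJ, hI⟩

/-- `vᵀ A(x)ᵀ A(x) v = ‖A(x) v‖²`, so the Gram matrix has the same kernel as `A(x)`. -/
theorem Regular.of_forall_ne (h : ∀ i, s D x i ≠ 0)
    (h0 : ∀ v : Fin d → ℝ, Ax D x *ᵥ v = 0 → v = 0) : Regular D x := by
  refine ⟨h, ?_⟩
  rw [isUnit_iff_ne_zero]
  intro hdet
  obtain ⟨v, hv, hv0⟩ := Matrix.exists_mulVec_eq_zero_iff.2 hdet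
  refine hv (h0 v ?_)
  rw [← Matrix.mulVec_mulVec] at hv0
  have h1 := congrArg (v ⬝ᵥ ·) hv0
  rw [Matrix.dotProduct_mulVec, Matrix.vecMul_transpose, dotProduct_zero] at h1
  exact dotProduct_self_eq_zero.1 h1

theorem jac_mul_jac_nonneg {σ : Matrix (Fin n) (Fin n) ℝ} (hσ : σᵀ = σ) (u : Fin n → ℝ) :
    0 ≤ u ⬝ᵥ ((jac σ * jac σ) *ᵥ u) := by
  rw [← Matrix.mulVec_mulVec, Matrix.dotProduct_mulVec, ← Matrix.mulVec_transpose,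
    jac_transpose hσ, dotProduct_self_eq]
  positivity

theorem dotProduct_conj_mulVec (X : Matrix (Fin n) (Fin d) ℝ) (K : Matrix (Fin n) (Fin n) ℝ)
    (u v : Fin d → ℝ) : u ⬝ᵥ ((Xᵀ * K * X) *ᵥ v) = (X *ᵥ u) ⬝ᵥ (K *ᵥ (X *ᵥ v)) := by
  rw [← Matrix.mulVec_mulVec, ← Matrix.mulVec_mulVec, Matrix.dotProduct_mulVec,
    Matrix.vecMul_transpose]

theorem dotProduct_hessForm (X : Matrix (Fin n) (Fin d) ℝ) (σ : Matrix (Fin n) (Fin n) ℝ)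
    (u v : Fin d → ℝ) : u ⬝ᵥ (hessForm D X σ *ᵥ v) =
      4 * ((X *ᵥ u) ⬝ᵥ ((jac σ * jac σ) *ᵥ (X *ᵥ v))) + (X *ᵥ u) ⬝ᵥ (indef D σ *ᵥ (X *ᵥ v)) +
        ∑ i, D.w i ^ 2 * ((D.A *ᵥ u) i * (D.A *ᵥ v) i) := by
  rw [hessForm, Matrix.add_mulVec, dotProduct_add, dotProduct_conj_mulVec, dotProduct_conj_mulVec,
    Matrix.add_mulVec, dotProduct_add, Matrix.smul_mulVec, dotProduct_smul, smul_eq_mul]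
  congr 1
  simp only [dotProduct, Matrix.mulVec_diagonal]
  exact Finset.sum_congr rfl fun i _ => by ring

theorem indef_transpose {σ : Matrix (Fin n) (Fin n) ℝ} (hσ : σᵀ = σ) :
    (indef D σ)ᵀ = indef D σ := by
  have h : (resid D σ)ᵀ = resid D σ := by rw [resid_eq, Matrix.diagonal_transpose]
  simp only [indef, Matrix.transpose_add, Matrix.transpose_sub, Matrix.transpose_smul,
    Matrix.transpose_mul, Matrix.transpose_hadamard, Matrix.transpose_one, hσ, h, Matrix.mul_assoc]
  rw [resid_eq, Matrix.one_hadamard, Matrix.diagonal_mul_diagonal, Matrix.diagonal_mul_diagonal]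
  simp only [mul_comm]
  abel

theorem hessForm_transpose (X : Matrix (Fin n) (Fin d) ℝ) {σ : Matrix (Fin n) (Fin n) ℝ}
    (hσ : σᵀ = σ) : (hessForm D X σ)ᵀ = hessForm D X σ := by
  simp only [hessForm, Matrix.transpose_add, Matrix.transpose_smul, Matrix.transpose_mul,
    indef_transpose hσ, jac_transpose hσ, Matrix.diagonal_transpose, Matrix.transpose_transpose,
    Matrix.mul_assoc]

theorem hessian_transpose (h : Regular D x) : (hessian (loss D) x)ᵀ = hessian (loss D) x := by
  rw [hessian_loss h, hessForm_transpose _ (lev_transpose D x)]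

theorem posSemidef_sub_smul_one {H : Matrix (Fin d) (Fin d) ℝ} {l : ℝ} (hH : Hᵀ = H)
    (h : ∀ v, l * l2 v ^ 2 ≤ v ⬝ᵥ (H *ᵥ v)) : (H - l • (1 : Matrix (Fin d) (Fin d) ℝ)).PosSemidef := by
  refine Matrix.PosSemidef.of_dotProduct_mulVec_nonneg ?_ fun v => ?_
  · rw [Matrix.IsHermitian, Matrix.conjTranspose_eq_transpose_of_trivial]
    simp [hH]
  · have := h v
    simp only [star_trivial, Matrix.sub_mulVec, dotProduct_sub, Matrix.smul_mulVec,
      Matrix.one_mulVec, dotProduct_smul, dotProduct_self_eq, smul_eq_mul]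
    linarith

theorem hessian_posSemidef_of_weights {l γ : ℝ} (hl : 0 < l) (hc : ∀ i, 0 ≤ D.c i ∧ D.c i ≤ 1)
    (hγ : 0 < γ) (hA : 0 < sigmaMin D.A)
    (hw : ∀ i, 44 / γ ^ 2 + l / sigmaMin D.A ^ 2 ≤ D.w i ^ 2) (hs : ∀ i, γ ≤ |s D x i|) :
    (hessian (loss D) x - l • (1 : Matrix (Fin d) (Fin d) ℝ)).PosSemidef := by
  have hs0 : ∀ i, s D x i ≠ 0 := fun i => abs_pos.1 (hγ.trans_le (hs i))
  have hreg : Regular D x := by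
    refine Regular.of_forall_ne hs0 fun v hv => ?_
    have h1 : D.A *ᵥ v = 0 := by
      ext i
      have := congrFun hv i
      rw [Ax_mulVec hs0] at this
      simpa [hs0 i] using this
    have h2 := sigmaMin_mul_le D.A v
    have h3 : l2 (D.A *ᵥ v) = 0 := by rw [h1, l2]; simp
    have h4 : l2 v = 0 := by nlinarith [l2_nonneg v]
    simpa [l2] using h4
  refine posSemidef_sub_smul_one (hessian_transpose hreg) fun v => ?_
  rw [hessian_loss hreg, dotProduct_hessForm]
  set u := Ax D x *ᵥ v
  -- Only the bound `28` for the indefinite part is needed, because `4 J²` is nonnegative; `44 = 4 ·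
  -- 2² + 28` would bound the whole middle factor.
  have hK := ((near_indef hc hreg.2 hreg.2 (δ := 0) (by simp)).2).1
  have h1 := abs_dotProduct_mulVec_le (indef D (lev D x)) u u
  have h2 : ‖indef D (lev D x)‖ * (l2 u * l2 u) ≤ 44 * l2 u ^ 2 := by
    rw [pow_two]
    exact mul_le_mul_of_nonneg_right (hK.trans (by norm_num)) (mul_self_nonneg _)
  have h3 := jac_mul_jac_nonneg (lev_transpose D x) u
  have h4 : l2 u ^ 2 ≤ l2 (D.A *ᵥ v) ^ 2 / γ ^ 2 := by
    rw [l2_sq, l2_sq, Finset.sum_div]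
    refine Finset.sum_le_sum fun i _ => ?_
    rw [show u i = _ from Ax_mulVec hs0 v i, mul_pow, inv_pow, inv_mul_eq_div, ← sq_abs (s D x i)]
    have := hs i
    gcongr
  have h5 : (44 / γ ^ 2 + l / sigmaMin D.A ^ 2) * l2 (D.A *ᵥ v) ^ 2 ≤
      ∑ i, D.w i ^ 2 * ((D.A *ᵥ v) i * (D.A *ᵥ v) i) := by
    rw [l2_sq, Finset.mul_sum]
    refine Finset.sum_le_sum fun i _ => ?_
    rw [← pow_two]
    exact mul_le_mul_of_nonneg_right (hw i) (sq_nonneg _)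
  have h6 : l * l2 v ^ 2 ≤ l / sigmaMin D.A ^ 2 * l2 (D.A *ᵥ v) ^ 2 := by
    have := pow_le_pow_left₀ (mul_nonneg hA.le (l2_nonneg v)) (sigmaMin_mul_le D.A v) 2
    rw [div_mul_eq_mul_div, le_div_iff₀ (by positivity)]
    nlinarith
  have h7 : 44 * (l2 (D.A *ᵥ v) ^ 2 / γ ^ 2) = 44 / γ ^ 2 * l2 (D.A *ᵥ v) ^ 2 := by ring
  rw [add_mul] at h5
  linarith [(abs_le.1 h1).1]

/-- The Hessian is Lipschitz along a segment on which `s` and `A(x)` are bounded below. -/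
theorem norm_hessian_sub_le {a e : EuclideanSpace ℝ (Fin d)} {ρ : ℝ} (hρ : 0 ≤ ρ)
    (hc : ∀ i, 0 ≤ D.c i ∧ D.c i ≤ 1)
    (hreg : ∀ t ∈ Set.Icc (0 : ℝ) 1, Regular D (a + t • e))
    (hA : ∀ t ∈ Set.Icc (0 : ℝ) 1, ‖Ax D (a + t • e)‖ ≤ ρ) :
    ‖hessian (loss D) (a + e) - hessian (loss D) a‖ ≤ 624 * ρ ^ 3 * ‖e‖ := by
  have hz : ∀ t ∈ Set.Icc (0 : ℝ) 1, ‖Matrix.diagonal (Ax D (a + t • e) *ᵥ e.ofLp)‖ ≤ ρ * ‖e‖ := by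
    intro t ht
    rw [Matrix.l2_opNorm_diagonal]
    have h1 := (l2_mulVec_le (Ax D (a + t • e)) e.ofLp).trans
      (mul_le_mul_of_nonneg_right (hA t ht) (norm_nonneg e))
    refine le_trans ((pi_norm_le_iff_of_nonneg (norm_nonneg _)).2 fun i => ?_) h1
    exact PiLp.norm_apply_le (WithLp.toLp 2 (Ax D (a + t • e) *ᵥ e.ofLp)) i
  have hX : ‖Ax D (a + e) - Ax D a‖ ≤ ρ ^ 2 * ‖e‖ :=
    MatHasDir.norm_sub_le (fun t ht => matHasDir_Ax (hreg t ht).1) fun t ht => by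
      rw [norm_neg]
      refine (Matrix.l2_opNorm_mul _ _).trans
        ((mul_le_mul (hz t ht) (hA t ht) (norm_nonneg _) (by positivity)).trans_eq (by ring))
  have hσ : ‖lev D (a + e) - lev D a‖ ≤ 4 * (ρ * ‖e‖) :=
    MatHasDir.norm_sub_le (fun t ht => matHasDir_lev (hreg t ht)) fun t ht => by
      have h1 := opNorm_lev_le (hreg t ht).2
      have h2 := hz t ht
      set σ := lev D (a + t • e)
      set Z := Matrix.diagonal (Ax D (a + t • e) *ᵥ e.ofLp)
      have h3 : ‖σ * Z‖ ≤ 1 * (ρ * ‖e‖) := (norm_mul_le _ _).trans (by gcongr)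
      have h4 : ‖Z * σ‖ ≤ (ρ * ‖e‖) * 1 := (norm_mul_le _ _).trans (by gcongr)
      have h5 : ‖σ * Z * σ‖ ≤ 1 * (ρ * ‖e‖) * 1 := (norm_mul_le _ _).trans (by gcongr)
      have h6 : ‖(2 : ℝ) • (σ * Z * σ)‖ ≤ 2 * (1 * (ρ * ‖e‖) * 1) := by
        rw [norm_smul]; norm_num at h5 ⊢; linarith
      refine (norm_sub_le_of_le (norm_sub_le_of_le h6 h4) h3).trans_eq (by ring)
  have h0 : Regular D a := by simpa using hreg 0 (by simp)
  have h1 : Regular D (a + e) := by simpa using hreg 1 (by simp)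
  have hXn : Near ρ (ρ ^ 2 * ‖e‖) (Ax D (a + e)) (Ax D a) :=
    ⟨by simpa using hA 1 (by simp), by simpa using hA 0 (by simp), hX⟩
  obtain ⟨hJ, hI⟩ := near_indef hc h1.2 h0.2 hσ
  -- The middle factor has norm at most `4 · 4 + 28 = 44` and varies by `(4 · 12 + 86) · 4 ρ ‖e‖ =
  -- 536 ρ ‖e‖`. The two outer factors add `2 · 44 ρ³ ‖e‖`, for a total of `624 ρ³ ‖e‖`. The
  -- regularizer has constant Hessian and cancels.
  have hK := (hXn.transpose.mul (((hJ.mul hJ).smul (c := 4) (by norm_num)).add hI)).mul hXn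
  rw [hessian_loss h0, hessian_loss h1, hessForm, hessForm, add_sub_add_right_eq_sub]
  exact hK.2.2.trans_eq (by ring)

end LeverageBounds

/-! ### Contraction and convergence of the exact Newton iteration. -/

section Newton

open scoped Matrix.Norms.L2Operator

variable {n d : ℕ} {D : Data n d}

theorem opNorm_Ax_le {x : EuclideanSpace ℝ (Fin d)} {R β : ℝ} (hβ : 0 < β) (hR : specNorm D.A ≤ R)
    (hs : ∀ i, β ≤ |s D x i|) : ‖Ax D x‖ ≤ R / β := by
  have hs0 : ∀ i, s D x i ≠ 0 := fun i => abs_pos.1 (hβ.trans_le (hs i))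
  have h1 : Ax D x = Matrix.diagonal (fun i => (s D x i)⁻¹) * D.A := by
    ext i j
    rw [Ax_apply hs0, Matrix.diagonal_mul]
  have h2 : ‖Matrix.diagonal (fun i => (s D x i)⁻¹)‖ ≤ β⁻¹ := by
    rw [Matrix.l2_opNorm_diagonal, pi_norm_le_iff_of_nonneg (by positivity)]
    intro i
    rw [norm_inv, Real.norm_eq_abs]
    exact inv_anti₀ hβ (hs i)
  rw [h1, div_eq_inv_mul]
  exact (Matrix.l2_opNorm_mul _ _).trans
    (mul_le_mul h2 hR (norm_nonneg _) (inv_nonneg.2 hβ.le))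

theorem regular_of_sigmaMin {x : EuclideanSpace ℝ (Fin d)} (hs : ∀ i, s D x i ≠ 0)
    (h : 0 < sigmaMin (Ax D x)) : Regular D x := by
  refine Regular.of_forall_ne hs fun v hv => ?_
  have h2 := sigmaMin_mul_le (Ax D x) v
  have h3 : l2 (Ax D x *ᵥ v) = 0 := by rw [hv, l2]; simp
  have h4 : l2 v = 0 := by nlinarith [l2_nonneg v]
  simpa [l2] using h4

theorem le_opNorm_of_le_sigmaMin (hd : 0 < d) {A : Matrix (Fin n) (Fin d) ℝ} {β : ℝ}
    (h : β ≤ sigmaMin A) : β ≤ ‖A‖ := by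
  have h1 : l2 (Pi.single ⟨0, hd⟩ (1 : ℝ) : Fin d → ℝ) = 1 := by
    have := PiLp.norm_single 2 (fun _ : Fin d => ℝ) ⟨0, hd⟩ (1 : ℝ)
    rwa [norm_one] at this
  have h2 := (sigmaMin_mul_le A (Pi.single ⟨0, hd⟩ 1)).trans (l2_mulVec_le A _)
  rw [h1] at h2
  linarith

/-- One exact Newton step contracts the distance to a nondegenerate minimum by the factor `9`. -/
theorem newtonStep_contract {l ρ r : ℝ} {xs x : EuclideanSpace ℝ (Fin d)} (hl : 0 < l) (hρ : 0 ≤ ρ)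
    (hc : ∀ i, 0 ≤ D.c i ∧ D.c i ≤ 1)
    (hK : ∀ y, ‖y - xs‖ ≤ r → Regular D y ∧ ‖Ax D y‖ ≤ ρ)
    (hmin : IsLocalMinimum l (loss D) xs) (hr : 624 * ρ ^ 3 * r ≤ l / 10) (hx : ‖x - xs‖ ≤ r) :
    (hessian (loss D) x).PosDef ∧ ‖newtonStep (loss D) x - xs‖ ≤ ‖x - xs‖ / 9 := by
  obtain ⟨e, rfl⟩ : ∃ e, x = xs + e := ⟨x - xs, by abel⟩
  rw [add_sub_cancel_left] at hx ⊢
  have hseg : ∀ t ∈ Set.Icc (0 : ℝ) 1, ‖xs + t • e - xs‖ ≤ r := fun t ht => by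
    rw [add_sub_cancel_left, norm_smul, Real.norm_of_nonneg ht.1]
    exact (mul_le_of_le_one_left (norm_nonneg _) ht.2).trans hx
  have hdiff : ∀ t ∈ Set.Icc (0 : ℝ) 1,
      ‖hessian (loss D) (xs + e) - hessian (loss D) (xs + t • e)‖ ≤ l / 10 := by
    intro t ht
    have hmem : ∀ τ ∈ Set.Icc (0 : ℝ) 1, ‖xs + t • e + τ • ((1 - t) • e) - xs‖ ≤ r := by
      intro τ hτ
      have := hseg (t + τ * (1 - t))
        ⟨by nlinarith [ht.1, ht.2, hτ.1], by nlinarith [ht.1, ht.2, hτ.2]⟩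
      rwa [add_smul, mul_smul, ← add_assoc] at this
    have h1 := norm_hessian_sub_le hρ hc (fun τ hτ => (hK _ (hmem τ hτ)).1)
      (fun τ hτ => (hK _ (hmem τ hτ)).2)
    rw [add_assoc, ← add_smul, add_sub_cancel, one_smul] at h1
    refine h1.trans (le_trans ?_ hr)
    refine mul_le_mul_of_nonneg_left ?_ (by positivity)
    rw [norm_smul, Real.norm_of_nonneg (by linarith [ht.2])]
    exact (mul_le_of_le_one_left (norm_nonneg _) (by linarith [ht.1])).trans hx
  set H := hessian (loss D) (xs + e) with hH
  have hreg : Regular D (xs + e) := (hK _ (by simpa using hx)).1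
  -- The Hessian at the minimum is at least `l I`, and the Hessian at the current point differs from
  -- it by at most `l / 10`.
  have hlow : ∀ v, 9 / 10 * l * l2 v ^ 2 ≤ v ⬝ᵥ (H *ᵥ v) := by
    intro v
    have h1 := hmin.2.dotProduct_mulVec_nonneg v
    have h2 := abs_dotProduct_mulVec_le (H - hessian (loss D) xs) v v
    have h3 : ‖H - hessian (loss D) xs‖ * (l2 v * l2 v) ≤ l / 10 * (l2 v * l2 v) :=
      mul_le_mul_of_nonneg_right (by simpa using hdiff 0 (by simp)) (mul_self_nonneg _)
    simp only [star_trivial, Matrix.sub_mulVec, dotProduct_sub, Matrix.smul_mulVec,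
      Matrix.one_mulVec, dotProduct_smul, dotProduct_self_eq, smul_eq_mul] at h1 h2
    have h4 := (abs_le.1 h2).1
    nlinarith
  have hpd : H.PosDef := by
    refine Matrix.PosDef.of_dotProduct_mulVec_pos ?_ fun v hv => ?_
    · rw [Matrix.IsHermitian, Matrix.conjTranspose_eq_transpose_of_trivial]
      exact hessian_transpose hreg
    · have h1 : 0 < v ⬝ᵥ v := (Matrix.dotProduct_star_self_pos_iff (v := v)).2 hv
      rw [dotProduct_self_eq] at h1
      exact lt_of_lt_of_le (by positivity) (hlow v)
  refine ⟨hpd, ?_⟩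
  set g := (gradient (loss D) (xs + e)).ofLp with hg
  -- Because the gradient vanishes at `xs`, `H e - g` is the increment of `y ↦ H y - ∇L(y)` from
  -- `xs` to `xs + e`. Its derivative is the difference of two Hessians, of norm at most `l / 10` on
  -- the whole segment.
  have hres : l2 (H *ᵥ e.ofLp - g) ≤ l / 10 * ‖e‖ := by
    refine l2_le_of_dotProduct_le (by positivity) fun u => ?_
    set U := WithLp.toLp 2 u
    have h1 := HasDir.abs_sub_le (a := xs) (e := e) (C := l / 10 * ‖e‖ * l2 u)
      (f := fun y : EuclideanSpace ℝ (Fin d) => u ⬝ᵥ (H *ᵥ y.ofLp) - fderiv ℝ (loss D) y U)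
      (f' := fun t z => u ⬝ᵥ (H *ᵥ z.ofLp) - z.ofLp ⬝ᵥ (hessian (loss D) (xs + t • e) *ᵥ u))
      (fun t ht => (HasDir.sum (s := Finset.univ) fun i =>
        (hasDir_mulVec H i _).const_mul (u i)).sub (hasDir_fderiv_loss (hK _ (hseg t ht)).1 U))
      (fun t ht => by
        have h2 : e.ofLp ⬝ᵥ (hessian (loss D) (xs + t • e) *ᵥ u) =
            u ⬝ᵥ (hessian (loss D) (xs + t • e) *ᵥ e.ofLp) := by
          rw [Matrix.dotProduct_mulVec, ← Matrix.mulVec_transpose,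
            hessian_transpose (hK _ (hseg t ht)).1, dotProduct_comm]
        rw [h2, ← dotProduct_sub, ← Matrix.sub_mulVec]
        refine (abs_dotProduct_mulVec_le _ _ _).trans
          ((mul_le_mul_of_nonneg_right (hdiff t ht)
            (mul_nonneg (l2_nonneg _) (l2_nonneg _))).trans_eq ?_)
        rw [← l2_ofLp e]; ring)
    refine le_trans (le_of_eq ?_) ((le_abs_self _).trans h1)
    rw [fderiv_eq_dotProduct, fderiv_eq_dotProduct, hmin.1]
    simp only [dotProduct_sub, WithLp.ofLp_add, Matrix.mulVec_add, dotProduct_add,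
      WithLp.ofLp_zero, zero_dotProduct]
    rw [dotProduct_comm u g]
    ring
  set p := newtonStep (loss D) (xs + e) - xs with hp
  -- The new error `p` satisfies `H p = H e - g`; with the lower bound on `H` this gives `0.9 l ‖p‖
  -- ≤ 0.1 l ‖e‖`.
  have hHp : H *ᵥ p.ofLp = H *ᵥ e.ofLp - g := by
    have : p.ofLp = e.ofLp - H⁻¹ *ᵥ g := by
      rw [hp, newtonStep]
      ext i
      simp [← hH, ← hg]
      ring
    rw [this, Matrix.mulVec_sub, Matrix.mulVec_mulVec,
      Matrix.mul_nonsing_inv _ (isUnit_iff_ne_zero.2 hpd.det_pos.ne'), Matrix.one_mulVec]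
  have h1 := hlow p.ofLp
  have h2 := (le_abs_self _).trans (abs_dotProduct_le p.ofLp (H *ᵥ p.ofLp))
  rw [hHp] at h1 h2
  rw [l2_ofLp] at h1 h2
  have h3 := mul_le_mul_of_nonneg_left hres (norm_nonneg p)
  rcases (norm_nonneg p).eq_or_lt with h0 | h0
  · rw [← h0]; positivity
  · have h4 : ‖p‖ * (9 / 10 * l * ‖p‖) ≤ ‖p‖ * (l / 10 * ‖e‖) := by nlinarith
    have h5 := le_of_mul_le_mul_left h4 h0
    have h6 : l * (9 * ‖p‖) ≤ l * ‖e‖ := by linarith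
    linarith [le_of_mul_le_mul_left h6 hl]

theorem newtonIter_converges (hd : 0 < d) {l R β : ℝ} {xs x₀ : EuclideanSpace ℝ (Fin d)}
    (hl : 0 < l) (hc : ∀ i, 0 ≤ D.c i ∧ D.c i ≤ 1) (hR0 : 0 < R) (hβ : 0 < β) (hβ1 : β < 1 / 10)
    (hR : specNorm D.A ≤ R)
    (hK : ∀ x : EuclideanSpace ℝ (Fin d), ‖x - xs‖ ≤ ‖x₀ - xs‖ →
      (∀ i, β ≤ |s D x i|) ∧ β ≤ sigmaMin (Ax D x))
    (hmin : IsLocalMinimum l (loss D) xs)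
    (hinit : GoodInit l (812 * (β ^ 9)⁻¹ * R ^ 5) x₀ xs) :
    (∀ t : ℕ, NewtonDefined D (newtonIter (loss D) x₀ t) ∧
      (hessian (loss D) (newtonIter (loss D) x₀ t)).PosDef) ∧
    ∀ (ε : ℝ) (T : ℕ), 0 < ε → 1 ≤ T → Real.log (‖x₀ - xs‖ / ε) ≤ T →
      ‖newtonIter (loss D) x₀ T - xs‖ < ε := by
  have hK' : ∀ y, ‖y - xs‖ ≤ ‖x₀ - xs‖ → Regular D y ∧ ‖Ax D y‖ ≤ R / β := fun y hy =>
    ⟨regular_of_sigmaMin (fun i => abs_pos.1 (hβ.trans_le ((hK y hy).1 i)))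
      (hβ.trans_le (hK y hy).2), opNorm_Ax_le hβ hR (hK y hy).1⟩
  have hβR : β ≤ R / β :=
    (le_opNorm_of_le_sigmaMin hd (hK x₀ le_rfl).2).trans (hK' x₀ le_rfl).2
  -- The Lipschitz constant with `ρ = R / β` is below `M`: from `β ≤ ‖A(x₀)‖ ≤ R / β` comes `β² ≤
  -- R`, and with `β < 1` also `β⁶ ≤ R²`, so the surplus factor `R² / β⁶` is at least `1`.
  have hM : 624 * (R / β) ^ 3 ≤ 812 * (β ^ 9)⁻¹ * R ^ 5 := by
    have h1 : β ^ 2 ≤ R := by rw [le_div_iff₀ hβ] at hβR; nlinarith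
    have h2 : β ^ 6 ≤ R ^ 2 := calc
      β ^ 6 ≤ β ^ 4 := pow_le_pow_of_le_one hβ.le (by linarith) (by norm_num)
      _ = (β ^ 2) ^ 2 := by ring
      _ ≤ R ^ 2 := by gcongr
    have h3 : 812 * (β ^ 9)⁻¹ * R ^ 5 = 812 * (R / β) ^ 3 * (R ^ 2 / β ^ 6) := by
      field_simp
    have h4 : 1 ≤ R ^ 2 / β ^ 6 := (one_le_div (by positivity)).2 h2
    rw [h3]
    have h5 : 0 < (R / β) ^ 3 := by positivity
    nlinarith
  have hr : 624 * (R / β) ^ 3 * ‖x₀ - xs‖ ≤ l / 10 := by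
    refine le_trans ?_ hinit
    rw [mul_comm]
    exact mul_le_mul_of_nonneg_left hM (norm_nonneg _)
  have hstep := fun (x : EuclideanSpace ℝ (Fin d)) (hx : ‖x - xs‖ ≤ ‖x₀ - xs‖) =>
    newtonStep_contract hl (by positivity) hc hK' hmin hr hx
  -- The bound itself keeps every iterate in the initial ball, where the contraction applies again.
  have hiter : ∀ t : ℕ, ‖newtonIter (loss D) x₀ t - xs‖ ≤ ‖x₀ - xs‖ / 9 ^ t := by
    intro t
    induction t with
    | zero => simp [newtonIter]
    | succ t ih =>
      rw [newtonIter, Function.iterate_succ_apply']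
      refine (hstep _ (ih.trans (div_le_self (norm_nonneg _) (one_le_pow₀ (by norm_num))))).2.trans ?_
      rw [pow_succ, ← div_div]
      exact div_le_div_of_nonneg_right ih (by norm_num)
  have hball : ∀ t : ℕ, ‖newtonIter (loss D) x₀ t - xs‖ ≤ ‖x₀ - xs‖ := fun t =>
    (hiter t).trans (div_le_self (norm_nonneg _) (one_le_pow₀ (by norm_num)))
  refine ⟨fun t => ?_, fun ε T hε hT hlog => ?_⟩
  · have hpd := (hstep _ (hball t)).1
    have hreg := (hK' _ (hball t)).1
    exact ⟨⟨hreg.1, hreg.2, isUnit_iff_ne_zero.2 hpd.det_pos.ne'⟩, hpd⟩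
  · refine (hiter T).trans_lt ?_
    rcases (norm_nonneg (x₀ - xs)).eq_or_lt with h0 | h0
    · rw [← h0, zero_div]; exact hε
    · have h1 : ‖x₀ - xs‖ / ε ≤ Real.exp T := (Real.log_le_iff_le_exp (by positivity)).1 hlog
      -- Since `e < 9`; strictness requires `T ≥ 1`.
      have h2 : Real.exp T < 9 ^ T := by
        rw [← mul_one (T : ℝ), Real.exp_nat_mul]
        exact pow_lt_pow_left₀ (Real.exp_one_lt_d9.trans (by norm_num)) (Real.exp_pos _).le
          (by omega)
      rw [div_le_iff₀ hε] at h1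
      rw [div_lt_iff₀ (by positivity)]
      nlinarith

end Newton

/-! ### Cost calculus for straight-line programs and a lower bound for matrix multiplication. -/

section StraightLine

variable {ι X : Type}

theorem execCode_append (inp : ι → ℝ) (c c' : List (Instr ι)) (m : List ℝ) :
    execCode inp (c ++ c') m = (execCode inp c m).bind (execCode inp c') := by
  induction c generalizing m with
  | nil => rfl
  | cons a c ih =>
    simp only [List.cons_append, execCode]
    cases a.eval inp m with
    | none => rfl
    | some v => exact ih _

theorem readAddr_append {inp : ι → ℝ} {m : List ℝ} {p : ι ⊕ ℕ} {r : ℝ} (m' : List ℝ)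
    (h : readAddr inp m p = some r) : readAddr inp (m ++ m') p = some r := by
  cases p with
  | inl i => exact h
  | inr k =>
    simp only [readAddr] at h ⊢
    obtain ⟨hk, -⟩ := List.getElem?_eq_some_iff.1 h
    rwa [List.getElem?_append_left hk]

/-- Some code with at most `N` instructions computes all functions in `S` on all inputs. -/
def Comp (inp : X → ι → ℝ) (N : ℕ) (S : Set (X → ℝ)) : Prop :=
  ∃ code : List (Instr ι), code.length ≤ N ∧ ∃ m : X → List ℝ,
    (∀ x, execCode (inp x) code [] = some (m x) ∧ (m x).length = code.length) ∧
    ∀ f ∈ S, ∃ a, ∀ x, readAddr (inp x) (m x) a = some (f x)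

/-- Once the functions in `S` are available, those in `T` cost at most `M` more instructions. -/
def Adds (inp : X → ι → ℝ) (S : Set (X → ℝ)) (M : ℕ) (T : Set (X → ℝ)) : Prop :=
  ∀ N S', S ⊆ S' → Comp inp N S' → Comp inp (N + M) (S' ∪ T)

variable {inp : X → ι → ℝ} {S T U : Set (X → ℝ)} {M M' N : ℕ} {f g : X → ℝ}

theorem comp_empty (inp : X → ι → ℝ) : Comp inp 0 ∅ :=
  ⟨[], le_rfl, fun _ => [], fun _ => ⟨rfl, rfl⟩, fun _ h => h.elim⟩

theorem Comp.mono (h : Comp inp N S) (hT : T ⊆ S) (hM : N ≤ M) : Comp inp M T := by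
  obtain ⟨code, h1, m, h2, h3⟩ := h
  exact ⟨code, h1.trans hM, m, h2, fun f hf => h3 f (hT hf)⟩

theorem Comp.exists_program {κ : Type} {F : X → κ → ℝ} (h : Comp inp N S)
    (hF : ∀ k, (fun x => F x k) ∈ S) :
    ∃ P : Program ι κ, P.steps ≤ N ∧ ∀ x, P.Outputs (inp x) (F x) := by
  obtain ⟨code, h1, m, h2, h3⟩ := h
  choose out hout using fun k => h3 _ (hF k)
  exact ⟨⟨code, out⟩, h1, fun x => ⟨m x, (h2 x).1, fun k => hout k x⟩⟩

theorem adds_of_subset (h : T ⊆ S) : Adds inp S 0 T := fun _ _ hS hc =>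
  hc.mono (Set.union_subset le_rfl (h.trans hS)) le_rfl

theorem Adds.mono {S' T' : Set (X → ℝ)} (h : Adds inp S M T) (hS : S ⊆ S') (hT : T' ⊆ T)
    (hM : M ≤ M') : Adds inp S' M' T' := fun N _ hS' hc =>
  (h N _ (hS.trans hS') hc).mono (Set.union_subset_union_right _ hT) (by omega)

/-- Costs add because `Adds` is stated for every larger set of available functions, so earlier
results stay readable. -/
theorem Adds.trans (h : Adds inp S M T) (h' : Adds inp (S ∪ T) M' U) :
    Adds inp S (M + M') (T ∪ U) := fun N S' hS hc => by
  have := h' _ _ (Set.union_subset_union_left T hS) (h N S' hS hc)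
  rwa [Set.union_assoc, add_assoc] at this

theorem Adds.union (h : Adds inp S M T) (h' : Adds inp S M' U) : Adds inp S (M + M') (T ∪ U) :=
  h.trans (h'.mono Set.subset_union_left le_rfl le_rfl)

theorem adds_biUnion {κ : Type*} [DecidableEq κ] (s : Finset κ) {T : κ → Set (X → ℝ)}
    (h : ∀ k ∈ s, Adds inp S M (T k)) : Adds inp S (s.card * M) (⋃ k ∈ s, T k) := by
  induction s using Finset.induction_on with
  | empty => exact (adds_of_subset (by simp)).mono le_rfl le_rfl (by simp)
  | insert a s ha ih =>
    have := (ih fun k hk => h k (Finset.mem_insert_of_mem hk)).union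
      (h a (Finset.mem_insert_self a s))
    refine this.mono le_rfl ?_ ?_
    · rw [Finset.set_biUnion_insert, Set.union_comm]
    · rw [Finset.card_insert_of_notMem ha]
      exact le_of_eq (by ring)

theorem adds_range {κ : Type*} [Fintype κ] {F : κ → X → ℝ} (h : ∀ k, Adds inp S M {F k}) :
    Adds inp S (Fintype.card κ * M) (Set.range F) := by
  classical
  refine (adds_biUnion Finset.univ fun k _ => h k).mono le_rfl ?_ le_rfl
  rintro _ ⟨k, rfl⟩
  simp

theorem adds_of_instr {k : X → ℝ}
    (h : ∀ m : X → List ℝ, (∀ f ∈ S, ∃ a, ∀ x, readAddr (inp x) (m x) a = some (f x)) →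
      ∃ i : Instr ι, ∀ x, i.eval (inp x) (m x) = some (k x)) : Adds inp S 1 {k} := by
  rintro N S' hS ⟨code, h1, m, h2, h3⟩
  obtain ⟨i, hi⟩ := h m fun f hf => h3 f (hS hf)
  refine ⟨code ++ [i], by simpa using h1, fun x => m x ++ [k x], fun x => ⟨?_, ?_⟩, fun f hf => ?_⟩
  · rw [execCode_append, (h2 x).1]
    simp [execCode, hi]
  · simp [(h2 x).2]
  · rcases hf with hf | rfl
    · obtain ⟨a, ha⟩ := h3 f hf
      exact ⟨a, fun x => readAddr_append _ (ha x)⟩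
    -- The new value sits at the end of memory. That address is the same for all inputs because
    -- `Comp` records the memory length.
    · refine ⟨.inr code.length, fun x => ?_⟩
      simp [readAddr, ← (h2 x).2]

theorem adds_const (r : ℝ) : Adds inp S 1 {fun _ => r} :=
  adds_of_instr fun _ _ => ⟨.const r, fun _ => rfl⟩

theorem adds_input (j : ι) : Adds inp S 0 {fun x => inp x j} := by
  rintro N S' _ ⟨code, h1, m, h2, h3⟩
  refine ⟨code, h1, m, h2, fun f hf => ?_⟩
  rcases hf with hf | rfl
  · exact h3 f hf
  · exact ⟨.inl j, fun x => rfl⟩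

theorem adds_op {k : X → ℝ} (o : ArithOp) (hf : f ∈ S) (hg : g ∈ S)
    (h : ∀ x, o.eval (f x) (g x) = some (k x)) : Adds inp S 1 {k} :=
  adds_of_instr fun m hm => by
    obtain ⟨a, ha⟩ := hm f hf
    obtain ⟨b, hb⟩ := hm g hg
    exact ⟨.op o a b, fun x => by simp [Instr.eval, ha, hb, h]⟩

theorem Adds.op {k : X → ℝ} (o : ArithOp) (hf : Adds inp S M {f}) (hg : Adds inp S M' {g})
    (h : ∀ x, o.eval (f x) (g x) = some (k x)) : Adds inp S (M + M' + 1) {k} :=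
  ((hf.union hg).trans (adds_op o (by simp) (by simp) h)).mono le_rfl Set.subset_union_right le_rfl

theorem Adds.add (hf : Adds inp S M {f}) (hg : Adds inp S M' {g}) :
    Adds inp S (M + M' + 1) {fun x => f x + g x} := hf.op .add hg fun _ => rfl

theorem Adds.sub (hf : Adds inp S M {f}) (hg : Adds inp S M' {g}) :
    Adds inp S (M + M' + 1) {fun x => f x - g x} := hf.op .sub hg fun _ => rfl

theorem Adds.mul (hf : Adds inp S M {f}) (hg : Adds inp S M' {g}) :
    Adds inp S (M + M' + 1) {fun x => f x * g x} := hf.op .mul hg fun _ => rfl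

theorem Adds.div (hf : Adds inp S M {f}) (hg : Adds inp S M' {g}) (h : ∀ x, g x ≠ 0) :
    Adds inp S (M + M' + 1) {fun x => f x / g x} :=
  hf.op .div hg fun x => by simp [ArithOp.eval, h x]

theorem adds_mem (h : f ∈ S) : Adds inp S 0 {f} := adds_of_subset (by simpa using h)

theorem adds_sum {κ : Type*} [DecidableEq κ] (s : Finset κ) {F : κ → X → ℝ}
    (h : ∀ k ∈ s, Adds inp S M {F k}) :
    Adds inp S (s.card * (M + 1) + 1) {fun x => ∑ k ∈ s, F k x} := by
  induction s using Finset.induction_on with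
  | empty => simpa using adds_const (inp := inp) (S := S) 0
  | insert a s ha ih =>
    have := (h a (Finset.mem_insert_self a s)).add (ih fun k hk => h k (Finset.mem_insert_of_mem hk))
    simp only [Finset.sum_insert ha, Finset.card_insert_of_notMem ha]
    exact this.mono le_rfl le_rfl (le_of_eq (by ring))

/-- The entries of a family of matrices. -/
def ents {a b : ℕ} (Y : X → Matrix (Fin a) (Fin b) ℝ) : Set (X → ℝ) :=
  Set.range fun (p : Fin a × Fin b) x => Y x p.1 p.2

theorem mem_ents {a b : ℕ} (Y : X → Matrix (Fin a) (Fin b) ℝ) (i : Fin a) (j : Fin b) :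
    (fun x => Y x i j) ∈ ents Y := ⟨(i, j), rfl⟩

theorem adds_ents {a b : ℕ} {Y : X → Matrix (Fin a) (Fin b) ℝ}
    (h : ∀ i j, Adds inp S M {fun x => Y x i j}) : Adds inp S (a * b * M) (ents Y) :=
  (adds_range fun p : Fin a × Fin b => h p.1 p.2).mono le_rfl le_rfl (by simp)

theorem adds_mul {a b c : ℕ} {Y : X → Matrix (Fin a) (Fin b) ℝ} {Z : X → Matrix (Fin b) (Fin c) ℝ}
    (hY : ents Y ⊆ S) (hZ : ents Z ⊆ S) :
    Adds inp S (a * c * (b * 2 + 1)) (ents fun x => Y x * Z x) :=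
  adds_ents fun i j => by
    have := adds_sum (inp := inp) Finset.univ fun (k : Fin b) _ =>
      (adds_mem (hY (mem_ents Y i k))).mul (adds_mem (hZ (mem_ents Z k j)))
    simpa [Matrix.mul_apply] using this

/-- The infimum of a set of naturals is attained once the set is nonempty; schoolbook multiplication
provides a member. -/
theorem Tmat_attained (a b c : ℕ) :
    ∃ P : Program ((Fin a × Fin b) ⊕ (Fin b × Fin c)) (Fin a × Fin c), P.steps = Tmat a b c ∧
      ∀ (Y : Matrix (Fin a) (Fin b) ℝ) (Z : Matrix (Fin b) (Fin c) ℝ),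
        P.Outputs (matInput Y Z) fun p => (Y * Z) p.1 p.2 := by
  apply Nat.sInf_mem (s := {N | ∃ P : Program ((Fin a × Fin b) ⊕ (Fin b × Fin c)) (Fin a × Fin c),
    P.steps = N ∧ ∀ (X : Matrix (Fin a) (Fin b) ℝ) (Y : Matrix (Fin b) (Fin c) ℝ),
      P.Outputs (matInput X Y) fun p => (X * Y) p.1 p.2})
  let inp : Matrix (Fin a) (Fin b) ℝ × Matrix (Fin b) (Fin c) ℝ →
    (Fin a × Fin b) ⊕ (Fin b × Fin c) → ℝ := fun q => matInput q.1 q.2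
  have h1 : Adds inp ∅ _ (ents fun q => q.1) := adds_ents fun i j =>
    adds_input (Sum.inl (i, j))
  have h2 : Adds inp ∅ _ (ents fun q => q.2) := adds_ents fun i j =>
    adds_input (Sum.inr (i, j))
  have h3 := (h1.union h2).trans (adds_mul (Set.subset_union_left.trans Set.subset_union_right)
    (Set.subset_union_right.trans Set.subset_union_right))
  obtain ⟨P, -, hP⟩ := (h3 0 ∅ le_rfl (comp_empty inp)).exists_program
    (F := fun (q : Matrix (Fin a) (Fin b) ℝ × Matrix (Fin b) (Fin c) ℝ) (p : Fin a × Fin c) =>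
      (q.1 * q.2) p.1 p.2)
    fun p => Set.mem_union_right _ (Set.mem_union_right _ (mem_ents _ p.1 p.2))
  exact ⟨_, P, rfl, fun Y Z => hP (Y, Z)⟩

/-- The addresses that an instruction reads. -/
def Instr.reads : Instr ι → List (ι ⊕ ℕ)
  | .const _ => []
  | .op _ p q => [p, q]

theorem execCode_congr {inp inp' : ι → ℝ} (code : List (Instr ι))
    (h : ∀ i ∈ code, ∀ j, Sum.inl j ∈ i.reads → inp j = inp' j) (m : List ℝ) :
    execCode inp code m = execCode inp' code m := by
  induction code generalizing m with
  | nil => rfl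
  | cons a code ih =>
    have hr : ∀ p ∈ a.reads, readAddr inp m p = readAddr inp' m p := by
      rintro (j | k) hp
      · exact congrArg some (h a (by simp) j hp)
      · rfl
    have ha : a.eval inp m = a.eval inp' m := by
      cases a with
      | const r => rfl
      | op o p q => simp [Instr.eval, hr p (by simp [Instr.reads]), hr q (by simp [Instr.reads])]
    simp only [execCode, ha]
    congr 1
    funext v
    exact ih (fun i hi => h i (by simp [hi])) _

theorem length_flatMap_reads (code : List (Instr ι)) :
    (code.flatMap Instr.reads).length ≤ 2 * code.length := by
  induction code with
  | nil => simp
  | cons a code ih =>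
    rw [List.flatMap_cons, List.length_append, List.length_cons]
    have : a.reads.length ≤ 2 := by cases a <;> simp [Instr.reads]
    omega

/-- Multiplication programs read every entry of the second factor. -/
theorem mul_le_two_mul_Tmat {a b c : ℕ} (ha : 0 < a) : b * c ≤ 2 * Tmat a b c := by
  classical
  obtain ⟨P, hP, hout⟩ := Tmat_attained a b c
  have hread : ∀ p : Fin b × Fin c,
      (Sum.inl (Sum.inr p) : ((Fin a × Fin b) ⊕ (Fin b × Fin c)) ⊕ ℕ) ∈
        P.code.flatMap Instr.reads := by
    rintro ⟨k, j⟩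
    by_contra hp
    let i : Fin a := ⟨0, ha⟩
    let Y : Matrix (Fin a) (Fin b) ℝ := Matrix.single i k 1
    let Z : Matrix (Fin b) (Fin c) ℝ := Matrix.single k j 1
    -- If entry `(k, j)` is never read, the runs on `(Y, Z)` and `(Y, 0)` produce the same memory,
    -- yet entry `(i, j)` of the product is `1` in one and `0` in the other. The third run, on `(0,
    -- Z)`, covers an output address that points directly at an entry of the second factor.
    obtain ⟨m, hm, hr⟩ := hout Y Z
    obtain ⟨m', hm', hr'⟩ := hout Y 0
    obtain ⟨m₀, -, hr₀⟩ := hout 0 Z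
    have hmm : m = m' := by
      rw [← Option.some_inj, ← hm, ← hm']
      refine execCode_congr _ (fun q hq p hpq => ?_) _
      rcases p with p | ⟨k', j'⟩
      · rfl
      · by_cases e : k = k' ∧ j = j'
        · obtain ⟨rfl, rfl⟩ := e
          exact (hp (List.mem_flatMap.2 ⟨q, hq, hpq⟩)).elim
        · simp [matInput, Z, e]
    have h1 := hr (i, j)
    have h0 := hr' (i, j)
    have h2 := hr₀ (i, j)
    subst hmm
    simp only [Y, Z, Matrix.single_mul_single_same, Matrix.single_apply_same, mul_one,
      Matrix.mul_zero, Matrix.zero_mul, Matrix.zero_apply] at h0 h1 h2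
    generalize P.out (i, j) = o at h0 h1 h2
    rcases o with (p | p) | q
    · exact one_ne_zero (Option.some.inj (h1.symm.trans h0))
    · exact one_ne_zero (Option.some.inj (h1.symm.trans h2))
    · exact one_ne_zero (Option.some.inj (h1.symm.trans h0))
  have hcard := Finset.card_le_card (s := (Finset.univ : Finset (Fin b × Fin c)).map
    ⟨fun p => (Sum.inl (Sum.inr p) : ((Fin a × Fin b) ⊕ (Fin b × Fin c)) ⊕ ℕ),
      fun _ _ h => Sum.inr_injective (Sum.inl_injective h)⟩)
    (t := (P.code.flatMap Instr.reads).toFinset) (by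
      intro q hq
      simp only [Finset.mem_map, Finset.mem_univ, true_and] at hq
      obtain ⟨p, rfl⟩ := hq
      exact List.mem_toFinset.2 (hread p))
  rw [Finset.card_map, Finset.card_univ, Fintype.card_prod, Fintype.card_fin,
    Fintype.card_fin] at hcard
  exact hcard.trans ((List.toFinset_card_le _).trans
    ((length_flatMap_reads _).trans_eq (by rw [← hP, Program.steps])))

end StraightLine

/-! ### Inversion of positive definite matrices by successive pivots. -/

section Sweep

variable {d : ℕ}

/-- Exchange of the `k`-th input with the `k`-th output of the linear map with matrix `N`. -/
noncomputable def exchange (k : Fin d) (N : Matrix (Fin d) (Fin d) ℝ) :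
    Matrix (Fin d) (Fin d) ℝ :=
  Matrix.of fun i j =>
    if i = k then if j = k then 1 / N k k else 0 - N k j / N k k
    else if j = k then N i k / N k k else N i j - N i k * (N k j / N k k)

/-- Solve the `k`-th equation for `z k`, which the nonzero pivot permits, and substitute into the
others. -/
theorem exchange_mulVec {k : Fin d} {N : Matrix (Fin d) (Fin d) ℝ} (hp : N k k ≠ 0)
    (w z : Fin d → ℝ) :
    w = N *ᵥ z ↔ Function.update w k (z k) = exchange k N *ᵥ Function.update z k (w k) := by
  set ρ : Fin d → ℝ := fun i => ∑ j ∈ Finset.univ.erase k, N i j * z j with hρ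
  have h1 : ∀ i, (N *ᵥ z) i = N i k * z k + ρ i := fun i => by
    rw [Matrix.mulVec, dotProduct, ← Finset.add_sum_erase _ _ (Finset.mem_univ k)]
  have h2 : ∀ i, (exchange k N *ᵥ Function.update z k (w k)) i =
      if i = k then (w k - ρ k) / N k k
      else N i k * ((w k - ρ k) / N k k) + ρ i := fun i => by
    rw [Matrix.mulVec, dotProduct, ← Finset.add_sum_erase _ _ (Finset.mem_univ k)]
    split_ifs with hi
    · subst hi
      have : ∑ j ∈ Finset.univ.erase i, exchange i N i j * Function.update z i (w i) j =
          -(ρ i / N i i) := by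
        rw [hρ, Finset.sum_div, ← Finset.sum_neg_distrib]
        refine Finset.sum_congr rfl fun j hj => ?_
        have hj' := Finset.ne_of_mem_erase hj
        simp [exchange, hj']
        ring
      rw [this]
      simp [exchange]
      ring
    · have : ∑ j ∈ Finset.univ.erase k, exchange k N i j * Function.update z k (w k) j =
          ρ i - N i k * (ρ k / N k k) := by
        rw [hρ, Finset.sum_div, Finset.mul_sum, ← Finset.sum_sub_distrib]
        refine Finset.sum_congr rfl fun j hj => ?_
        have hj' := Finset.ne_of_mem_erase hj
        simp [exchange, hj', hi]
        ring
      rw [this]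
      simp [exchange, hi]
      ring
  constructor
  · intro h
    have hk : z k = (w k - ρ k) / N k k := by
      rw [eq_div_iff hp, congrFun h k, h1]; ring
    ext i
    rw [h2, ← hk]
    by_cases hi : i = k
    · subst hi; simp
    · rw [Function.update_of_ne hi, if_neg hi, congrFun h i, h1]
  · intro h
    have hk : z k = (w k - ρ k) / N k k := by
      have := congrFun h k
      rwa [h2, if_pos rfl, Function.update_self] at this
    ext i
    rw [h1]
    by_cases hi : i = k
    · subst hi; rw [hk]; field_simp; ring
    · have := congrFun h i
      rwa [h2, if_neg hi, Function.update_of_ne hi, ← hk] at this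

/-- Exchange of the first `k` inputs and outputs, one after the other. -/
noncomputable def sweep (M : Matrix (Fin d) (Fin d) ℝ) : ℕ → Matrix (Fin d) (Fin d) ℝ
  | 0 => M
  | k + 1 => if h : k < d then exchange ⟨k, h⟩ (sweep M k) else sweep M k

/-- The vector with the first `k` entries of `x` and the remaining entries of `y`. -/
def splice (k : ℕ) (x y : Fin d → ℝ) : Fin d → ℝ := fun i => if (i : ℕ) < k then x i else y i

theorem splice_succ {k : ℕ} (h : k < d) (x y : Fin d → ℝ) :
    splice (k + 1) x y = Function.update (splice k x y) ⟨k, h⟩ (splice k y x ⟨k, h⟩) := by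
  ext i
  by_cases hi : i = ⟨k, h⟩
  · subst hi; simp [splice]
  · have : (i : ℕ) ≠ k := fun e => hi (Fin.ext e)
    rw [Function.update_of_ne hi]
    simp only [splice]
    congr 1
    simp only [eq_iff_iff]
    omega

theorem splice_splice (k : ℕ) (x y : Fin d → ℝ) : splice k (splice k x y) (splice k y x) = x := by
  ext i
  simp only [splice]
  split_ifs <;> rfl

/-- The graph of `M` is also the graph of `sweep M k`, with the first `k` coordinates of input and
output exchanged. Positive definiteness of `M` then forces the next pivot to be nonzero, which lets
the induction proceed. -/
theorem sweep_spec {M : Matrix (Fin d) (Fin d) ℝ} (hM : M.PosDef) (k : ℕ) (hk : k ≤ d) :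
    (∀ x y : Fin d → ℝ, y = M *ᵥ x ↔ splice k x y = sweep M k *ᵥ splice k y x) ∧
      ∀ h : k < d, sweep M k ⟨k, h⟩ ⟨k, h⟩ ≠ 0 := by
  have key : ∀ k, (∀ x y : Fin d → ℝ, y = M *ᵥ x ↔ splice k x y = sweep M k *ᵥ splice k y x) →
      ∀ h : k < d, sweep M k ⟨k, h⟩ ⟨k, h⟩ ≠ 0 := by
    intro k hspec h
    -- Feeding the unit vector `e_k` to the swept map and undoing the exchange gives a pair `y = M
    -- x` with `x k = 1`. Each product `xᵢ yᵢ` equals `wᵢ zᵢ`, so `xᵀ M x` is exactly the pivot.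
    set z : Fin d → ℝ := Pi.single ⟨k, h⟩ 1 with hz
    set w := sweep M k *ᵥ z with hw
    have hxy := (hspec (splice k w z) (splice k z w)).2
      (by rw [splice_splice, splice_splice])
    have hx : splice k w z ≠ 0 := fun h0 => by
      have := congrFun h0 ⟨k, h⟩
      simp [splice, hz] at this
    have hpos := hM.dotProduct_mulVec_pos hx
    rw [← hxy] at hpos
    have hsum : star (splice k w z) ⬝ᵥ splice k z w = w ⟨k, h⟩ := by
      rw [dotProduct, Finset.sum_eq_single ⟨k, h⟩]
      · simp [splice, hz]
      · intro i _ hi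
        simp only [splice, hz, star_trivial, Pi.single_eq_of_ne hi]
        split_ifs <;> simp
      · simp
    rw [hsum, hw, hz, Matrix.mulVec_single_one] at hpos
    exact hpos.ne'
  have main : ∀ k ≤ d, ∀ x y : Fin d → ℝ, y = M *ᵥ x ↔ splice k x y = sweep M k *ᵥ splice k y x := by
    intro k
    induction k with
    | zero =>
      intro _ x y
      have hs : ∀ u v : Fin d → ℝ, splice 0 u v = v := fun u v => by ext i; simp [splice]
      rw [hs, hs, sweep]
    | succ k ih =>
      intro hk x y
      have h : k < d := hk
      rw [ih h.le x y, exchange_mulVec (key k (ih h.le) h), ← splice_succ, ← splice_succ, sweep,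
        dif_pos h]
  exact ⟨main k hk, key k (main k hk)⟩

theorem sweep_eq_inv {M : Matrix (Fin d) (Fin d) ℝ} (hM : M.PosDef) : sweep M d = M⁻¹ := by
  symm
  apply Matrix.inv_eq_left_inv
  have hs : ∀ x y : Fin d → ℝ, splice d x y = x := fun x y => by ext i; simp [splice]
  apply Matrix.ext_of_mulVec_single
  intro j
  have h := ((sweep_spec hM d le_rfl).1 (Pi.single j 1) _).1 rfl
  rw [hs, hs] at h
  rw [← Matrix.mulVec_mulVec, ← h, Matrix.one_mulVec]

end Sweep

/-! ### Matrix operations in cubically many instructions. -/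

section CubicCost

variable {ι X : Type} {inp : X → ι → ℝ} {n a b k c c' : ℕ}

/-- The entries of the family `Y` can be computed in `c n³` instructions. -/
def Cubic (inp : X → ι → ℝ) (n c : ℕ) {a b : ℕ} (Y : X → Matrix (Fin a) (Fin b) ℝ) : Prop :=
  Adds inp ∅ (c * n ^ 3) (ents Y)

variable {Y : X → Matrix (Fin a) (Fin b) ℝ}

theorem Cubic.congr {Z : X → Matrix (Fin a) (Fin b) ℝ} (h : Cubic inp n c Y) (e : ∀ x, Y x = Z x) :
    Cubic inp n c Z := by
  rwa [show Z = Y from (funext e).symm]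

theorem Adds.cubic {T : Set (X → ℝ)} (hT : Adds inp ∅ (c * n ^ 3) T) (hn : 0 < n) (ha : a ≤ n)
    (hb : b ≤ n) (h : ∀ i j, Adds inp T c' {fun x => Y x i j}) : Cubic inp n (c + c') Y := by
  have h1 := hT.trans ((adds_ents h).mono (Set.subset_union_right (s := ∅)) le_rfl le_rfl)
  refine h1.mono le_rfl Set.subset_union_right ?_
  rw [add_mul]
  refine Nat.add_le_add_left ?_ _
  calc a * b * c' ≤ n * n * c' := by gcongr
    _ ≤ n * n * c' * n := Nat.le_mul_of_pos_right _ hn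
    _ = c' * n ^ 3 := by ring

theorem adds_zero_cubic : Adds inp ∅ (0 * n ^ 3) ∅ := by
  rw [zero_mul]; exact adds_of_subset le_rfl

theorem Cubic.union {a' b' : ℕ} {Z : X → Matrix (Fin a') (Fin b') ℝ} (hY : Cubic inp n c Y)
    (hZ : Cubic inp n c' Z) : Adds inp ∅ ((c + c') * n ^ 3) (ents Y ∪ ents Z) := by
  rw [add_mul]
  exact Adds.union hY hZ

theorem cubic_input (hn : 0 < n) (ha : a ≤ n) (hb : b ≤ n) (p : Fin a → Fin b → ι) :
    Cubic inp n 0 fun x => Matrix.of fun i j => inp x (p i j) :=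
  adds_zero_cubic.cubic hn ha hb fun i j => adds_input (p i j)

theorem cubic_const (hn : 0 < n) (ha : a ≤ n) (hb : b ≤ n) (A : Matrix (Fin a) (Fin b) ℝ) :
    Cubic inp n 1 fun _ : X => A :=
  (adds_zero_cubic.cubic (c' := 1) hn ha hb fun i j => adds_const (A i j))

theorem Cubic.transpose (hn : 0 < n) (ha : a ≤ n) (hb : b ≤ n) (hY : Cubic inp n c Y) :
    Cubic inp n c fun x => (Y x)ᵀ :=
  Adds.cubic (c' := 0) hY hn hb ha fun i j => adds_mem (mem_ents Y j i)

theorem Cubic.mul {Z : X → Matrix (Fin b) (Fin k) ℝ} (hn : 0 < n) (ha : a ≤ n) (hb : b ≤ n)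
    (hk : k ≤ n) (hY : Cubic inp n c Y) (hZ : Cubic inp n c' Z) :
    Cubic inp n (c + c' + 3) fun x => Y x * Z x := by
  have h1 := (hY.union hZ).trans
    ((adds_mul (inp := inp) (Y := Y) (Z := Z) Set.subset_union_left Set.subset_union_right).mono
      (Set.subset_union_right (s := ∅)) le_rfl le_rfl)
  refine h1.mono le_rfl Set.subset_union_right ?_
  rw [add_mul _ 3]
  refine Nat.add_le_add_left ?_ _
  calc a * k * (b * 2 + 1) ≤ n * n * (n * 2 + n) := by gcongr; exact hn
    _ = 3 * n ^ 3 := by ring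

theorem Cubic.entrywise₂ {Z K : X → Matrix (Fin a) (Fin b) ℝ} (hn : 0 < n) (ha : a ≤ n)
    (hb : b ≤ n) (hY : Cubic inp n c Y) (hZ : Cubic inp n c' Z) (o : ArithOp)
    (h : ∀ x i j, o.eval (Y x i j) (Z x i j) = some (K x i j)) : Cubic inp n (c + c' + 1) K :=
  (hY.union hZ).cubic hn ha hb fun i j => adds_op o (Set.mem_union_left _ (mem_ents Y i j))
    (Set.mem_union_right _ (mem_ents Z i j)) fun x => h x i j

theorem Cubic.add {Z : X → Matrix (Fin a) (Fin b) ℝ} (hn : 0 < n) (ha : a ≤ n)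
    (hb : b ≤ n) (hY : Cubic inp n c Y) (hZ : Cubic inp n c' Z) :
    Cubic inp n (c + c' + 1) fun x => Y x + Z x :=
  hY.entrywise₂ hn ha hb hZ .add fun _ _ _ => rfl

theorem Cubic.sub {Z : X → Matrix (Fin a) (Fin b) ℝ} (hn : 0 < n) (ha : a ≤ n)
    (hb : b ≤ n) (hY : Cubic inp n c Y) (hZ : Cubic inp n c' Z) :
    Cubic inp n (c + c' + 1) fun x => Y x - Z x :=
  hY.entrywise₂ hn ha hb hZ .sub fun _ _ _ => rfl

theorem Cubic.hadamard {Z : X → Matrix (Fin a) (Fin b) ℝ} (hn : 0 < n) (ha : a ≤ n)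
    (hb : b ≤ n) (hY : Cubic inp n c Y) (hZ : Cubic inp n c' Z) :
    Cubic inp n (c + c' + 1) fun x => Y x ⊙ Z x :=
  hY.entrywise₂ hn ha hb hZ .mul fun _ _ _ => rfl

theorem Cubic.smul (hn : 0 < n) (ha : a ≤ n) (hb : b ≤ n) (r : ℝ) (hY : Cubic inp n c Y) :
    Cubic inp n (1 + c + 1) fun x => r • Y x :=
  (cubic_const hn ha hb (Matrix.of fun _ _ => r)).entrywise₂ hn ha hb hY .mul fun _ _ _ => rfl

theorem Cubic.diagonal {v : X → Fin a → ℝ} (hn : 0 < n) (ha : a ≤ n)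
    (hv : Cubic inp n c fun x => Matrix.of fun i (_ : Fin 1) => v x i) :
    Cubic inp n (c + 1) fun x => Matrix.diagonal (v x) :=
  Adds.cubic hv hn ha ha fun i j => by
    by_cases h : i = j
    · subst h
      simp only [Matrix.diagonal_apply_eq]
      exact (adds_mem (mem_ents _ i 0)).mono le_rfl le_rfl (Nat.zero_le 1)
    · simpa [Matrix.diagonal_apply_ne _ h] using adds_const 0

/-- There are `a` pivots, each updating `a²` entries with at most three instructions per entry. -/
theorem Cubic.inv {M : X → Matrix (Fin a) (Fin a) ℝ} (ha : a ≤ n)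
    (hM : Cubic inp n c M) (hpd : ∀ x, (M x).PosDef) : Cubic inp n (c + 3) fun x => (M x)⁻¹ := by
  have hstep : ∀ k ≤ a, Adds inp ∅ (c * n ^ 3 + k * (a * a * 3)) (ents fun x => sweep (M x) k) := by
    intro k
    induction k with
    | zero =>
      intro _
      rw [Nat.zero_mul, Nat.add_zero]
      exact hM
    | succ k ih =>
      intro hk
      have h : k < a := hk
      have hpiv := fun x => (sweep_spec (hpd x) k h.le).2 h
      set T := ents fun x => sweep (M x) k
      have hm : ∀ i j, Adds inp T 0 {fun x => sweep (M x) k i j} := fun i j =>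
        adds_mem (mem_ents _ i j)
      have hent : Adds inp T (a * a * 3) (ents fun x => sweep (M x) (k + 1)) := by
        refine adds_ents fun i j => ?_
        simp only [sweep, dif_pos h, exchange, Matrix.of_apply]
        split_ifs
        · exact ((adds_const 1).div (hm _ _) hpiv).mono le_rfl le_rfl (by norm_num)
        · exact (adds_const 0).sub ((hm _ _).div (hm _ _) hpiv)
        · exact ((hm _ _).div (hm _ _) hpiv).mono le_rfl le_rfl (by norm_num)
        · exact (hm _ _).sub ((hm _ _).mul ((hm _ _).div (hm _ _) hpiv))
      refine ((ih h.le).trans (hent.mono (Set.subset_union_right (s := ∅)) le_rfl le_rfl)).mono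
        le_rfl Set.subset_union_right (le_of_eq (by ring))
  have h1 : Adds inp ∅ ((c + 3) * n ^ 3) (ents fun x => sweep (M x) a) := by
    refine (hstep a le_rfl).mono le_rfl le_rfl ?_
    rw [add_mul]
    refine Nat.add_le_add_left ?_ _
    calc a * (a * a * 3) ≤ n * (n * n * 3) := by gcongr
      _ = 3 * n ^ 3 := by ring
  exact Cubic.congr h1 fun x => sweep_eq_inv (hpd x)

end CubicCost

/-! ### A straight-line program for one Newton iteration. -/

section NewtonProgram

variable {n d : ℕ}

theorem NewtonDefined.regular {D : Data n d} {x : EuclideanSpace ℝ (Fin d)}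
    (h : NewtonDefined D x) : Regular D x := ⟨h.1, h.2.1⟩

/-- An invertible `d × d` Gram matrix has rank `d`, while `A(x)` has only `n` rows. -/
theorem NewtonDefined.dim_le {D : Data n d} {x : EuclideanSpace ℝ (Fin d)}
    (h : NewtonDefined D x) : d ≤ n := by
  have h1 := Matrix.rank_of_isUnit _ ((Matrix.isUnit_iff_isUnit_det _).2 h.2.1)
  rw [Fintype.card_fin] at h1
  rw [← h1]
  exact (Matrix.rank_mul_le_right _ _).trans (Matrix.rank_le_height _)

theorem posDef_transpose_mul_self {m : ℕ} {B : Matrix (Fin m) (Fin d) ℝ}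
    (h : IsUnit (Bᵀ * B).det) : (Bᵀ * B).PosDef := by
  rw [← Matrix.conjTranspose_eq_transpose_of_trivial] at h ⊢
  refine Matrix.PosDef.conjTranspose_mul_self _ fun u v huv => ?_
  apply Matrix.mulVec_injective_of_isUnit ((Matrix.isUnit_iff_isUnit_det _).2 h)
  simpa [← Matrix.mulVec_mulVec] using congrArg (Bᴴ *ᵥ ·) huv

/-- The gradient of the regularized loss, as a column. -/
theorem gradient_loss_apply {D : Data n d} {x : EuclideanSpace ℝ (Fin d)} (h : Regular D x)
    (j : Fin d) : (gradient (loss D) x).ofLp j =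
      ((2 : ℝ) • ((Ax D x)ᵀ * (jac (lev D x) *
        (resid D (lev D x) * Matrix.of fun (_ : Fin n) (_ : Fin 1) => (1 : ℝ)))) +
      D.Aᵀ * (Matrix.diagonal (fun i => D.w i ^ 2) *
        (D.A * Matrix.of fun i (_ : Fin 1) => x.ofLp i))) j 0 := by
  rw [gradient_apply, (hasDir_loss h).fderiv_apply, dloss, Matrix.add_apply, Matrix.smul_apply,
    smul_eq_mul]
  have hr : resid D (lev D x) * (Matrix.of fun (_ : Fin n) (_ : Fin 1) => (1 : ℝ)) =
      Matrix.of fun i (_ : Fin 1) => lev D x i i - D.c i := by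
    ext i k
    simp [resid_eq, Matrix.diagonal_mul]
  congr 1
  · congr 1
    rw [Matrix.dotProduct_mulVec, ← Matrix.mulVec_transpose, jac_transpose (lev_transpose D x),
      Matrix.dotProduct_mulVec, ← Matrix.mulVec_transpose, PiLp.ofLp_single,
      dotProduct_single_one, hr]
    rfl
  · rw [PiLp.ofLp_single]
    simp only [Matrix.mul_apply (M := D.Aᵀ), Matrix.diagonal_mul, Matrix.transpose_apply,
      Matrix.mulVec_single_one, Matrix.col_apply]
    refine Finset.sum_congr rfl fun i _ => ?_
    have : (D.A * Matrix.of fun i (_ : Fin 1) => x.ofLp i) i 0 = (D.A *ᵥ x.ofLp) i := rfl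
    rw [this]
    ring

theorem exists_newton_program : ∃ c : ℕ, ∀ n d : ℕ, 0 < d → d ≤ n →
    ∃ P : Program (NewtonVar n d) (Fin d), P.steps ≤ c * n ^ 3 ∧
      ∀ (D : Data n d) (x : EuclideanSpace ℝ (Fin d)), NewtonDefined D x →
        P.Outputs (newtonInput D x) fun j => newtonStep (loss D) x j := by
  -- A generous bound for the constant that the constructions below accumulate; it is checked
  -- numerically at the end.
  refine ⟨100000, fun n d hd hdn => ?_⟩
  have hn : 0 < n := hd.trans_le hdn
  have h1 : 1 ≤ n := hn
  let X := {p : Data n d × EuclideanSpace ℝ (Fin d) // NewtonDefined p.1 p.2}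
  let inp : X → NewtonVar n d → ℝ := fun p => newtonInput p.1.1 p.1.2
  let A : X → Matrix (Fin n) (Fin d) ℝ := fun p => p.1.1.A
  let B : X → Matrix (Fin n) (Fin d) ℝ := fun p => Ax p.1.1 p.1.2
  let σ : X → Matrix (Fin n) (Fin n) ℝ := fun p => lev p.1.1 p.1.2
  have hA : Cubic inp n _ A := cubic_input (inp := inp) hn le_rfl hdn fun i j => NewtonVar.A i j
  have hb : Cubic inp n _ fun p => Matrix.of fun i (_ : Fin 1) => p.1.1.b i :=
    cubic_input (inp := inp) hn le_rfl h1 fun i _ => NewtonVar.b i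
  have hc : Cubic inp n _ fun p => Matrix.of fun i (_ : Fin 1) => p.1.1.c i :=
    cubic_input (inp := inp) hn le_rfl h1 fun i _ => NewtonVar.c i
  have hw : Cubic inp n _ fun p => Matrix.of fun i (_ : Fin 1) => p.1.1.w i :=
    cubic_input (inp := inp) hn le_rfl h1 fun i _ => NewtonVar.w i
  have hx : Cubic inp n _ fun p => Matrix.of fun i (_ : Fin 1) => p.1.2.ofLp i :=
    cubic_input (inp := inp) hn hdn h1 fun i _ => NewtonVar.x i
  let scol : X → Matrix (Fin n) (Fin 1) ℝ := fun p => Matrix.of fun i _ => s p.1.1 p.1.2 i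
  have hs : Cubic inp n _ scol :=
    ((hA.mul hn le_rfl hdn h1 hx).sub hn le_rfl h1 hb).congr fun p => by
      ext i k; rfl
  have hB : Cubic inp n _ B := (hA.union hs).cubic (c' := 1) hn le_rfl hdn fun i j => by
    have := (adds_mem (inp := inp) (Set.mem_union_left _ (mem_ents A i j))).div
      (adds_mem (Set.mem_union_right (ents A) (mem_ents scol i 0))) fun p => p.2.1 i
    refine this.mono le_rfl ?_ le_rfl
    rintro _ rfl
    rw [Set.mem_singleton_iff]
    funext p
    change Ax p.1.1 p.1.2 i j = p.1.1.A i j / s p.1.1 p.1.2 i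
    rw [Ax_apply p.2.1, div_eq_inv_mul]
  have hBt := hB.transpose hn le_rfl hdn
  have hG := (hBt.mul hn hdn le_rfl hdn hB).inv hdn fun p => posDef_transpose_mul_self p.2.2.1
  have hσ : Cubic inp n _ σ := (hB.mul hn le_rfl hdn hdn hG).mul hn le_rfl hdn le_rfl hBt
  have hone := cubic_const (inp := inp) hn le_rfl le_rfl (1 : Matrix (Fin n) (Fin n) ℝ)
  have hdiag := hone.hadamard hn le_rfl le_rfl hσ
  have hr : Cubic inp n _ fun p => resid p.1.1 (σ p) :=
    hdiag.sub hn le_rfl le_rfl (hc.diagonal hn le_rfl)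
  have hq := hσ.hadamard hn le_rfl le_rfl hσ
  have hJ : Cubic inp n _ fun p => jac (σ p) := hq.sub hn le_rfl le_rfl hdiag
  have hσr := (hσ.mul hn le_rfl le_rfl le_rfl hr).mul hn le_rfl le_rfl le_rfl hσ
  have hI : Cubic inp n _ fun p => indef p.1.1 (σ p) :=
    (((((hdiag.mul hn le_rfl le_rfl le_rfl hr).smul hn le_rfl le_rfl 6).sub hn le_rfl le_rfl
      ((hr.mul hn le_rfl le_rfl le_rfl hq).smul hn le_rfl le_rfl 4)).sub hn le_rfl le_rfl
      ((hq.mul hn le_rfl le_rfl le_rfl hr).smul hn le_rfl le_rfl 4)).sub hn le_rfl le_rfl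
      ((hone.hadamard hn le_rfl le_rfl hσr).smul hn le_rfl le_rfl 6)).add hn le_rfl le_rfl
      ((hσ.hadamard hn le_rfl le_rfl hσr).smul hn le_rfl le_rfl 8)
  have hAt := hA.transpose hn le_rfl hdn
  have hW : Cubic inp n _ fun p => Matrix.diagonal (fun i => p.1.1.w i ^ 2) :=
    (Cubic.congr (hw.hadamard hn le_rfl h1 hw) fun p => by
      ext i k
      exact (pow_two (p.1.1.w i)).symm).diagonal hn le_rfl
  have hH : Cubic inp n _ fun p => hessian (loss p.1.1) p.1.2 :=
    (((hBt.mul hn hdn le_rfl le_rfl (((hJ.mul hn le_rfl le_rfl le_rfl hJ).smul hn le_rfl le_rfl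
      4).add hn le_rfl le_rfl hI)).mul hn hdn le_rfl hdn hB).add hn hdn hdn
      ((hAt.mul hn hdn le_rfl le_rfl hW).mul hn hdn le_rfl hdn hA)).congr fun p =>
        (hessian_loss p.2.regular).symm
  have hg : Cubic inp n _ fun p => Matrix.of fun j (_ : Fin 1) =>
      (gradient (loss p.1.1) p.1.2).ofLp j :=
    (((hBt.mul hn hdn le_rfl h1 (hJ.mul hn le_rfl le_rfl h1 (hr.mul hn le_rfl le_rfl h1
      (cubic_const hn le_rfl h1 (Matrix.of fun (_ : Fin n) (_ : Fin 1) => (1 : ℝ)))))).smul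
      hn hdn h1 2).add hn hdn h1 (hAt.mul hn hdn le_rfl h1 (hW.mul hn le_rfl le_rfl h1
      (hA.mul hn le_rfl hdn h1 hx)))).congr fun p => by
        ext j k
        obtain rfl : k = 0 := Subsingleton.elim _ _
        exact (gradient_loss_apply p.2.regular j).symm
  have hHt := hH.transpose hn hdn hdn
  -- The Hessian is only assumed invertible, so its pivots might vanish. Instead the positive
  -- definite `HᵀH` is inverted, and `H⁻¹ g = (HᵀH)⁻¹ (Hᵀ g)`.
  have hinv := (hHt.mul hn hdn hdn hdn hH).inv hdn fun p => posDef_transpose_mul_self (by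
    rw [Matrix.det_mul, Matrix.det_transpose]
    exact p.2.2.2.mul p.2.2.2)
  have hstep : Cubic inp n _ fun p => Matrix.of fun j (_ : Fin 1) =>
      (newtonStep (loss p.1.1) p.1.2).ofLp j :=
    (hx.sub hn hdn h1 (hinv.mul hn hdn hdn h1 (hHt.mul hn hdn hdn h1 hg))).congr fun p => by
      have hu : IsUnit (hessian (loss p.1.1) p.1.2)ᵀ.det := by
        rw [Matrix.det_transpose]; exact p.2.2.2
      rw [Matrix.mul_inv_rev, Matrix.mul_assoc, Matrix.nonsing_inv_mul_cancel_left _ _ hu]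
      ext j k
      rfl
  obtain ⟨P, hP, hout⟩ := (hstep 0 ∅ le_rfl (comp_empty inp)).exists_program
    (F := fun p j => (newtonStep (loss p.1.1) p.1.2).ofLp j)
    fun j => Set.mem_union_right _ (mem_ents _ j 0)
  rw [zero_add] at hP
  exact ⟨P, hP.trans (Nat.mul_le_mul_right _ (by norm_num)), fun D x hDx => hout ⟨(D, x), hDx⟩⟩

end NewtonProgram

end LevInv

/-! ### The main theorem. -/

theorem theorem9p2 :
    ∃ C : ℝ, 0 < C ∧ ∀ n d : ℕ, 0 < n → 0 < d →
      -- one program for all data of the given size performs a Newton iteration in the claimed time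
      ∃ P : LevInv.Program (LevInv.NewtonVar n d) (Fin d),
        (P.steps : ℝ) ≤
          n * (C * ((LevInv.Tmat d n n : ℝ) + (LevInv.Tmat d n d : ℝ))) + (d : ℝ) ^ LevInv.omega ∧
        (∀ (D : LevInv.Data n d) (x : EuclideanSpace ℝ (Fin d)), LevInv.NewtonDefined D x →
          P.Outputs (LevInv.newtonInput D x)
            (fun j => LevInv.newtonStep (LevInv.loss D) x j)) ∧
        ∀ (D : LevInv.Data n d) (l : ℝ), 0 < l → (∀ i, 0 ≤ D.c i ∧ D.c i ≤ 1) →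
          -- sufficiently large regularization weights make the Hessian positive definite
          (∀ γ : ℝ, 0 < γ → 0 < LevInv.sigmaMin D.A →
            (∀ i, 44 / γ ^ 2 + l / LevInv.sigmaMin D.A ^ 2 ≤ D.w i ^ 2) →
            ∀ x : EuclideanSpace ℝ (Fin d), (∀ i, γ ≤ |LevInv.s D x i|) →
              (LevInv.hessian (LevInv.loss D) x -
                l • (1 : Matrix (Fin d) (Fin d) ℝ)).PosSemidef) ∧
          -- convergence of the exact Newton iteration from a good initialization point
          (∀ (R β : ℝ) (xstar x₀ : EuclideanSpace ℝ (Fin d)),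
            0 < R → 0 < β → β < 1 / 10 → LevInv.specNorm D.A ≤ R →
            (∀ x : EuclideanSpace ℝ (Fin d), ‖x - xstar‖ ≤ ‖x₀ - xstar‖ →
              (∀ i, β ≤ |LevInv.s D x i|) ∧ β ≤ LevInv.sigmaMin (LevInv.Ax D x)) →
            LevInv.IsLocalMinimum l (LevInv.loss D) xstar →
            LevInv.GoodInit l (812 * (β ^ 9)⁻¹ * R ^ 5) x₀ xstar →
            (∀ t : ℕ,
              LevInv.NewtonDefined D (LevInv.newtonIter (LevInv.loss D) x₀ t) ∧
              (LevInv.hessian (LevInv.loss D)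
                (LevInv.newtonIter (LevInv.loss D) x₀ t)).PosDef) ∧
            ∀ (ε : ℝ) (T : ℕ), 0 < ε → 1 ≤ T → Real.log (‖x₀ - xstar‖ / ε) ≤ T →
              ‖LevInv.newtonIter (LevInv.loss D) x₀ T - xstar‖ < ε) := by
  obtain ⟨c, hc⟩ := LevInv.exists_newton_program
  refine ⟨2 * c + 1, by positivity, fun n d hn hd => ?_⟩
  have hP : ∃ P : LevInv.Program (LevInv.NewtonVar n d) (Fin d),
      (P.steps : ℝ) ≤ n * ((2 * c + 1) * ((LevInv.Tmat d n n : ℝ) + (LevInv.Tmat d n d : ℝ))) +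
        (d : ℝ) ^ LevInv.omega ∧
      ∀ (D : LevInv.Data n d) (x : EuclideanSpace ℝ (Fin d)), LevInv.NewtonDefined D x →
        P.Outputs (LevInv.newtonInput D x) (fun j => LevInv.newtonStep (LevInv.loss D) x j) := by
    rcases le_or_gt d n with hdn | hdn
    · obtain ⟨P, hP, hout⟩ := hc n d hd hdn
      refine ⟨P, ?_, hout⟩
      -- This lower bound turns `c n³` into at most `n · 2c · T_mat(d, n, n)`; the terms `T_mat(d,
      -- n, d)` and `d ^ ω` are merely nonnegative slack.
      have h1 : ((n * n : ℕ) : ℝ) ≤ ((2 * LevInv.Tmat d n n : ℕ) : ℝ) :=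
        Nat.cast_le.2 (LevInv.mul_le_two_mul_Tmat hd)
      have h2 : (P.steps : ℝ) ≤ ((c * n ^ 3 : ℕ) : ℝ) := Nat.cast_le.2 hP
      push_cast at h1 h2
      calc (P.steps : ℝ) ≤ c * (n : ℝ) ^ 3 := h2
        _ = n * (c * (n * n)) := by ring
        _ ≤ n * (c * (2 * (LevInv.Tmat d n n : ℝ))) := by gcongr
        _ = n * (2 * c * ((LevInv.Tmat d n n : ℝ) + 0)) := by ring
        _ ≤ n * ((2 * c + 1) * ((LevInv.Tmat d n n : ℝ) + (LevInv.Tmat d n d : ℝ))) := by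
          gcongr
          · linarith
          · positivity
        _ ≤ _ := le_add_of_nonneg_right (by positivity)
    -- For `d > n` no Newton step is defined, so the empty program, with arbitrary output addresses,
    -- suffices.
    · refine ⟨⟨[], fun j => .inl (.x j)⟩, ?_, fun D x h => (hdn.not_ge h.dim_le).elim⟩
      simp only [LevInv.Program.steps, List.length_nil, Nat.cast_zero]
      positivity
  obtain ⟨P, hsteps, hout⟩ := hP
  exact ⟨P, hsteps, hout, fun D l hl hcD =>
    ⟨fun γ hγ hA hw x hs => LevInv.hessian_posSemidef_of_weights hl hcD hγ hA hw hs,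
      fun R β xs x₀ hR0 hβ hβ1 hR hK hmin hinit =>
        LevInv.newtonIter_converges hd hl hcD hR0 hβ hβ1 hR hK hmin hinit⟩⟩
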